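/- Work over the hyperreals ${}^*\mathbb{R}$ (an ultrapower of $\mathbb R$ along a non-principal ultrafilter on $\mathbb N$), and in the dagger symmetric monoidal category ${}^*\mathrm{Hilb}$ of hyperfinite-dimensional non-standard Hilbert spaces and internal linear maps. For $a\in{}^*\mathbb{R}$ positive and $\omega\in{}^*\mathbb{N}$ positive, $\frac1a{}^*\mathbb{Z}_\omega$ is the group of non-standard integers modulo $\omega$, realised as the set of all $n/a\in{}^*\mathbb R$ with $-\lfloor\frac{\omega-1}2\rfloor\le n\le\lfloor\frac\omega2\rfloor$; $\mathrm{st}(\mathrm{fin}(\frac1a{}^*\mathbb{Z}_\omega))$ is the quotient of its subgroup of finite elements by the subgroup of infinitesimal ones, with the topology given by the standard part of the distance $|x-y|$, the difference being taken in the group. A quantum clock is a pair $(Z,X)$ of quasi-special symmetric $\dagger$-Frobenius algebras on an object $\mathcal G$ of ${}^*\mathrm{Hilb}$ which is strongly complementary (bialgebra law, coherence laws, bone law, self-adjoint antipode) with $Z$ special and commutative, together with non-infinitesimal positive $\omega_{uv},\omega_{ir}\in{}^*\mathbb R$ such that $\omega:=\omega_{uv}\omega_{ir}\in{}^*\mathbb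 N$ and an internal group isomorphism $t\mapsto|t\rangle$ from $\frac1{\omega_{uv}}{}^*\mathbb{Z}_\omega$ onto the classical states (copied, deleted and self-conjugate) of $Z$ under the multiplication and unit of $X$. Its standard time-translation group is $G=\mathrm{st}(\mathrm{fin}(\frac1{\omega_{uv}}{}^*\mathbb{Z}_\omega))$, and its plane-wave states are $|E\rangle:=\sum_{t\in\frac1{\omega_{uv}}{}^*\mathbb{Z}_\omega}e^{i2\pi Et}|t\rangle$ for $E\in\frac1{\omega_{ir}}{}^*\mathbb{Z}_\omega$. A quantum dynamical system with time-translation group $H$, a topological abelian group, is a strongly continuous unitary representation $U$ of $H$ on a Hilbert space; a possible value for its energy is a function $c:H\to\mathbb C$ such that $U_t\psi=c(t)\psi$ for all $t\in H$, for some $\psi\neq0$. **Proposition.** 1. For every topological abelian group $H$, the possible values for energy in quantum dynamical systems with time-translation group $H$ are exactly the (functions $t\mapsto\chi(t)$ given by the) elements $\chi$ of the Pontryagin dual $H^\wedge$. 2. For every quantum clock, $\langle E|t\rangle=e^{-i2\pi Et}$ for all $E,t$, and $E\mapsto|E\rangle$ is a group isomorphism from $\frac1{\omega_{ir}}{}^*\mathbb{Z}_\omega$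 onto the classical states of $X$ under the multiplication and unit of $Z$. 3. $G^\wedge\cong\mathrm{st}(\mathrm{fin}(\frac1{\omega_{ir}}{}^*\mathbb{Z}_\omega))$ as topological groups, by the pairing which sends the classes of finite $E$ and $t$ to $\mathrm{st}(e^{-i2\pi Et})$. 4. Hence the classical states of $X$ label the possible energies of quantum dynamical systems with time-translation group $G$: $c:G\to\mathbb C$ is such an energy if and only if there is a finite $E\in\frac1{\omega_{ir}}{}^*\mathbb{Z}_\omega$ with $c(\mathrm{st}\,t)=\mathrm{st}\langle E|t\rangle$ for all finite $t$, and then $E$ is unique up to infinitesimals. -/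

import Mathlib

open CategoryTheory MonoidalCategory Filter
open scoped TensorProduct

universe u v

noncomputable section

/-! ### The category of hyperfinite-dimensional Hilbert spaces

Non-standard objects are ultraproducts along the ultrafilter which defines the hyperreals `ℝ*`. -/

/-- A hyperfinite-dimensional non-standard Hilbert space: an ultraproduct of finite-dimensional
complex Hilbert spaces, presented by a sequence of representatives. -/
structure StarHilb : Type 1 where
  space : ℕ → Type
  [normed : ∀ n, NormedAddCommGroup (space n)]
  [inner : ∀ n, InnerProductSpace ℂ (space n)]
  [finDim : ∀ n, FiniteDimensional ℂ (space n)]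

namespace StarHilb

attribute [instance] normed inner finDim

/-- Internal linear maps: sequences of linear maps, up to equality on a set of the ultrafilter. -/
def Hom (A B : StarHilb) : Type :=
  (hyperfilter ℕ : Filter ℕ).Product fun n => A.space n →ₗ[ℂ] B.space n

namespace Hom

/-- The internal map with a given sequence of representatives. -/
def ofSeq {A B : StarHilb} (f : ∀ n, A.space n →ₗ[ℂ] B.space n) : Hom A B :=
  Quotient.mk (productSetoid _ _) f

theorem ind {A B : StarHilb} {p : Hom A B → Prop} (h : ∀ f, p (ofSeq f)) (f : Hom A B) : p f :=
  Quotient.ind h f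

theorem ofSeq_eq {A B : StarHilb} {f g : ∀ n, A.space n →ₗ[ℂ] B.space n} :
    ofSeq f = ofSeq g ↔ ∀ᶠ n in (hyperfilter ℕ : Filter ℕ), f n = g n :=
  Quotient.eq (r := productSetoid _ _)

/-- Apply an operation on linear maps componentwise. -/
def map {A B C D : StarHilb}
    (F : ∀ n, (A.space n →ₗ[ℂ] B.space n) → (C.space n →ₗ[ℂ] D.space n)) :
    Hom A B → Hom C D :=
  Quotient.map' (s₁ := productSetoid _ _) (s₂ := productSetoid _ _) (fun f n => F n (f n))
    fun _ _ h => h.mono fun n hn => congrArg (F n) hn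

/-- Apply a binary operation on linear maps componentwise. -/
def map₂ {A B C D P Q : StarHilb}
    (F : ∀ n, (A.space n →ₗ[ℂ] B.space n) → (C.space n →ₗ[ℂ] D.space n) →
      (P.space n →ₗ[ℂ] Q.space n)) :
    Hom A B → Hom C D → Hom P Q :=
  Quotient.map₂ (sa := productSetoid _ _) (sb := productSetoid _ _) (sc := productSetoid _ _)
    (fun f g n => F n (f n) (g n))
    fun _ _ h _ _ h' => (h.and h').mono fun n hn => congrArg₂ (F n) hn.1 hn.2

end Hom

instance : Category StarHilb where
  Hom := Hom
  id A := Hom.ofSeq fun _ => LinearMap.id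
  comp f g := Hom.map₂ (fun _ a b => b ∘ₗ a) f g
  id_comp f := by induction f using Hom.ind; rfl
  comp_id f := by induction f using Hom.ind; rfl
  assoc f g h := by
    induction f using Hom.ind
    induction g using Hom.ind
    induction h using Hom.ind
    rfl

/-- An internal isomorphism from a sequence of linear isomorphisms. -/
def isoOfSeq {A B : StarHilb} (e : ∀ n, A.space n ≃ₗ[ℂ] B.space n) : A ≅ B where
  hom := Hom.ofSeq fun n => (e n).toLinearMap
  inv := Hom.ofSeq fun n => (e n).symm.toLinearMap
  hom_inv_id := congrArg Hom.ofSeq (funext fun n => (e n).symm_comp)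
  inv_hom_id := congrArg Hom.ofSeq (funext fun n => (e n).comp_symm)

/-- The tensor product, tensor unit, associator and unitors, taken componentwise. -/
abbrev monoidalStruct : MonoidalCategoryStruct StarHilb where
  tensorObj A B := ⟨fun n => A.space n ⊗[ℂ] B.space n⟩
  tensorUnit := ⟨fun _ => ℂ⟩
  tensorHom f g := Hom.map₂ (fun _ a b => TensorProduct.map a b) f g
  whiskerLeft A _ _ f := Hom.map (fun n b => b.lTensor (A.space n)) f
  whiskerRight f B := Hom.map (fun n a => a.rTensor (B.space n)) f
  associator A B C := isoOfSeq fun n => TensorProduct.assoc ℂ (A.space n) (B.space n) (C.space n)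
  leftUnitor A := isoOfSeq fun n => TensorProduct.lid ℂ (A.space n)
  rightUnitor A := isoOfSeq fun n => TensorProduct.rid ℂ (A.space n)

instance : MonoidalCategory StarHilb :=
  letI := monoidalStruct
  MonoidalCategory.ofTensorHom
  (id_tensorHom_id := fun _ _ => congrArg Hom.ofSeq (funext fun n => TensorProduct.map_id))
  (id_tensorHom := fun _ _ _ f => by induction f using Hom.ind; rfl)
  (tensorHom_id := fun f _ => by induction f using Hom.ind; rfl)
  (tensorHom_comp_tensorHom := fun f₁ f₂ g₁ g₂ => by
    induction f₁ using Hom.ind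
    induction f₂ using Hom.ind
    induction g₁ using Hom.ind
    induction g₂ using Hom.ind
    exact congrArg Hom.ofSeq (funext fun n => (TensorProduct.map_comp _ _ _ _).symm))
  (associator_naturality := fun f₁ f₂ f₃ => by
    induction f₁ using Hom.ind
    induction f₂ using Hom.ind
    induction f₃ using Hom.ind
    exact congrArg Hom.ofSeq (funext fun n => TensorProduct.ext_threefold fun _ _ _ => rfl))
  (leftUnitor_naturality := fun f => by
    induction f using Hom.ind with | h f =>
    exact congrArg Hom.ofSeq (funext fun n => TensorProduct.ext' fun x y =>
      ((f n).map_smul x y).symm))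
  (rightUnitor_naturality := fun f => by
    induction f using Hom.ind with | h f =>
    exact congrArg Hom.ofSeq (funext fun n => TensorProduct.ext' fun x y =>
      ((f n).map_smul y x).symm))
  (pentagon := fun _ _ _ _ =>
    congrArg Hom.ofSeq (funext fun n => TensorProduct.ext_fourfold fun _ _ _ _ => rfl))
  (triangle := fun _ _ =>
    congrArg Hom.ofSeq (funext fun n => TensorProduct.ext_threefold fun x c y =>
      (TensorProduct.smul_tmul (R := ℂ) (R' := ℂ) (show ℂ from c) x y).symm))

instance : SymmetricCategory StarHilb where
  braiding A B := isoOfSeq fun n => TensorProduct.comm ℂ (A.space n) (B.space n)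
  braiding_naturality_right A _ _ f := by
    induction f using Hom.ind
    exact congrArg Hom.ofSeq (funext fun n => TensorProduct.ext' fun _ _ => rfl)
  braiding_naturality_left f A := by
    induction f using Hom.ind
    exact congrArg Hom.ofSeq (funext fun n => TensorProduct.ext' fun _ _ => rfl)
  hexagon_forward A B C :=
    congrArg Hom.ofSeq (funext fun n => TensorProduct.ext_threefold fun _ _ _ => rfl)
  hexagon_reverse A B C :=
    congrArg Hom.ofSeq (funext fun n => TensorProduct.ext (LinearMap.ext fun x =>
      TensorProduct.ext' fun y z => rfl))
  symmetry A B :=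
    congrArg Hom.ofSeq (funext fun n => TensorProduct.ext' fun _ _ => rfl)

/-- The dagger: the componentwise adjoint. -/
def dagger {A B : StarHilb} (f : A ⟶ B) : B ⟶ A :=
  Hom.map (A := A) (B := B) (C := B) (D := A) (fun _ a => LinearMap.adjoint a) f

end StarHilb

/-! ### Hyperfinite cyclic groups and their standard parts -/

/-- Non-standard natural numbers. -/
abbrev HNat : Type := Germ (hyperfilter ℕ : Filter ℕ) ℕ

/-- Non-standard integers. -/
abbrev HInt : Type := Germ (hyperfilter ℕ : Filter ℕ) ℤ

/-- Non-standard complex numbers. -/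
abbrev HComplex : Type := Germ (hyperfilter ℕ : Filter ℕ) ℂ

/-- The inclusion of the non-standard naturals in the non-standard integers. -/
def HNat.toInt (n : HNat) : HInt := Germ.map (fun k : ℕ => (k : ℤ)) n

/-- The inclusion of the non-standard naturals in the non-standard reals. -/
def HNat.toReal (n : HNat) : ℝ* := Germ.map (fun k : ℕ => (k : ℝ)) n

/-- The inclusion of the non-standard integers in the non-standard reals. -/
def HInt.toReal (m : HInt) : ℝ* := Germ.map (fun k : ℤ => (k : ℝ)) m

/-- The unit complex number `exp (2 π i x)` for a non-standard real `x`. -/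
def hyperPhase (x : ℝ*) : HComplex :=
  Germ.map (fun r : ℝ => Complex.exp (2 * Real.pi * Complex.I * r)) x

/-- The standard part of a (finite) non-standard complex number. -/
def complexStdPart (z : HComplex) : ℂ :=
  ⟨ArchimedeanClass.stdPart (Germ.map Complex.re z : ℝ*),
    ArchimedeanClass.stdPart (Germ.map Complex.im z : ℝ*)⟩

/-- The balanced residue of `m` modulo `ω`, in the interval from `-⌊(ω - 1) / 2⌋` to `⌊ω / 2⌋`. -/
def balancedMod (ω : HNat) (m : HInt) : HInt :=
  Germ.map₂ (fun (w : ℕ) (k : ℤ) => ((k : ZMod w)).valMinAbs) ω m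

/-- The group `(1/a) ℤ_ω`: non-standard integers modulo `ω` (where `m` stands for `m / a`), under
addition. It is identified with a set of non-standard reals through `ScaledZMod.val`. -/
def ScaledZMod (_a : ℝ*) (ω : HNat) : Type :=
  HInt ⧸ Ideal.span {ω.toInt}

namespace ScaledZMod

variable {a : ℝ*} {ω : HNat}

instance : AddCommGroup (ScaledZMod a ω) :=
  inferInstanceAs (AddCommGroup (HInt ⧸ Ideal.span {ω.toInt}))

/-- The class of `m / a`. -/
def mk (a : ℝ*) (ω : HNat) : HInt →+ ScaledZMod a ω :=
  (Ideal.Quotient.mk (Ideal.span {ω.toInt})).toAddMonoidHom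

theorem mk_surjective : Function.Surjective (mk a ω) := Ideal.Quotient.mk_surjective

theorem mk_eq_mk {m k : HInt} : mk a ω m = mk a ω k ↔ ∃ j : HInt, m - k = ω.toInt * j :=
  Ideal.Quotient.eq.trans Ideal.mem_span_singleton

theorem balancedMod_eq {m k : HInt} (h : ∃ j : HInt, m - k = ω.toInt * j) :
    balancedMod ω m = balancedMod ω k := by
  obtain ⟨j, h⟩ := h
  obtain rfl : m = ω.toInt * j + k := by rw [← h]; ring
  induction ω using Germ.inductionOn with | h w =>
  induction j using Germ.inductionOn with | h j =>
  induction k using Germ.inductionOn with | h k =>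
  refine Germ.coe_eq.2 (Eventually.of_forall fun n => ?_)
  simp

/-- The non-standard real number `n / a` representing a class, with `n` balanced. -/
def val (x : ScaledZMod a ω) : ℝ* :=
  (Quotient.liftOn' x (balancedMod ω) fun _ _ h =>
    balancedMod_eq (mk_eq_mk (a := a).1 (Quotient.sound' h))).toReal / a

theorem val_mk (m : HInt) : (mk a ω m).val = (balancedMod ω m).toReal / a := rfl

theorem val_zero : (0 : ScaledZMod a ω).val = 0 := by
  rw [← map_zero (mk a ω), val_mk]
  have h : (balancedMod ω 0).toReal = 0 := by
    induction ω using Germ.inductionOn with | h w =>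
    refine Germ.coe_eq.2 (Eventually.of_forall fun n => ?_)
    simp
  rw [h, zero_div]

theorem abs_val_add_le (x y : ScaledZMod a ω) : |(x + y).val| ≤ |x.val + y.val| := by
  obtain ⟨m, rfl⟩ := mk_surjective x
  obtain ⟨k, rfl⟩ := mk_surjective y
  rw [← map_add, val_mk, val_mk, val_mk, ← add_div, abs_div, abs_div]
  refine div_le_div_of_nonneg_right ?_ (abs_nonneg a)
  rw [← sq_le_sq]
  induction ω using Germ.inductionOn with | h w =>
  induction m using Germ.inductionOn with | h m =>
  induction k using Germ.inductionOn with | h k =>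
  refine Germ.coe_le.2 (Eventually.of_forall fun n => ?_)
  have h := ZMod.natAbs_valMinAbs_add_le (m n : ZMod (w n)) (k n : ZMod (w n))
  have h' := Int.natAbs_le_iff_sq_le.1 h
  simp only [← Int.cast_add] at h'
  show (((m n + k n : ℤ) : ZMod (w n)).valMinAbs : ℝ) ^ 2 ≤
    (((m n : ZMod (w n)).valMinAbs : ℝ) + ((k n : ZMod (w n)).valMinAbs : ℝ)) ^ 2
  exact_mod_cast h'

theorem abs_val_neg (x : ScaledZMod a ω) : |(-x).val| = |x.val| := by
  obtain ⟨m, rfl⟩ := mk_surjective x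
  rw [← map_neg, val_mk, val_mk, abs_div, abs_div]
  congr 1
  rw [← sq_eq_sq_iff_abs_eq_abs]
  induction ω using Germ.inductionOn with | h w =>
  induction m using Germ.inductionOn with | h m =>
  refine Germ.coe_eq.2 (Eventually.of_forall fun n => ?_)
  have h := Int.natAbs_eq_iff_sq_eq.1 (ZMod.natAbs_valMinAbs_neg (m n : ZMod (w n)))
  simp only [← Int.cast_neg] at h
  show (((-m n : ℤ) : ZMod (w n)).valMinAbs : ℝ) ^ 2 = ((m n : ZMod (w n)).valMinAbs : ℝ) ^ 2
  exact_mod_cast h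

/-- As a set of non-standard reals, `(1/a) ℤ_ω` consists of the `n / a` with `n` balanced. -/
theorem range_val (hω : 0 < ω) :
    Set.range (val : ScaledZMod a ω → ℝ*) =
      {x | ∃ n : HInt, -((ω.toInt - 1) / 2) ≤ n ∧ n ≤ ω.toInt / 2 ∧ x = n.toReal / a} := by
  have key : ∀ n : HInt,
      (-((ω.toInt - 1) / 2) ≤ n ∧ n ≤ ω.toInt / 2) ↔ balancedMod ω n = n := by
    intro n
    induction ω using Germ.inductionOn with | h w =>
    induction n using Germ.inductionOn with | h n =>
    have hw : ∀ᶠ i in (hyperfilter ℕ : Filter ℕ), 0 < w i := Germ.coe_lt.1 hω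
    have e1 : (-((HNat.toInt (w : HNat) - 1) / 2) ≤ (n : HInt)) ↔
        ∀ᶠ i in (hyperfilter ℕ : Filter ℕ), -(((w i : ℤ) - 1) / 2) ≤ n i := Germ.coe_le
    have e2 : ((n : HInt) ≤ HNat.toInt (w : HNat) / 2) ↔
        ∀ᶠ i in (hyperfilter ℕ : Filter ℕ), n i ≤ (w i : ℤ) / 2 := Germ.coe_le
    have e3 : (balancedMod (w : HNat) (n : HInt) = (n : HInt)) ↔
        ∀ᶠ i in (hyperfilter ℕ : Filter ℕ), ((n i : ZMod (w i))).valMinAbs = n i := Germ.coe_eq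
    rw [e1, e2, e3, ← eventually_and]
    refine eventually_congr (hw.mono fun i hi => ?_)
    have : NeZero (w i) := ⟨hi.ne'⟩
    rw [ZMod.valMinAbs_spec]
    simp only [Set.mem_Ioc, true_and]
    omega
  ext x
  constructor
  · rintro ⟨y, rfl⟩
    obtain ⟨m, rfl⟩ := mk_surjective y
    have := (key (balancedMod ω m)).2 (by
      induction ω using Germ.inductionOn with | h w =>
      induction m using Germ.inductionOn with | h m =>
      refine Germ.coe_eq.2 (Eventually.of_forall fun n => ?_)
      simp)
    exact ⟨balancedMod ω m, this.1, this.2, rfl⟩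
  · rintro ⟨n, h1, h2, rfl⟩
    exact ⟨mk a ω n, by rw [val_mk, (key n).1 ⟨h1, h2⟩]⟩

theorem val_injective (ha : a ≠ 0) : Function.Injective (val : ScaledZMod a ω → ℝ*) := by
  intro x y h
  obtain ⟨m, rfl⟩ := mk_surjective x
  obtain ⟨k, rfl⟩ := mk_surjective y
  rw [val_mk, val_mk, div_left_inj' ha] at h
  rw [mk_eq_mk]
  induction ω using Germ.inductionOn with | h w =>
  induction m using Germ.inductionOn with | h m =>
  induction k using Germ.inductionOn with | h k =>
  have h' : ∀ᶠ i in (hyperfilter ℕ : Filter ℕ),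
      (((m i : ZMod (w i)).valMinAbs : ℤ) : ℝ) = ((k i : ZMod (w i)).valMinAbs : ℤ) :=
    Germ.coe_eq.1 h
  have h'' : ∀ᶠ i in (hyperfilter ℕ : Filter ℕ), ∃ j : ℤ, m i - k i = w i * j := h'.mono fun i hi => by
    have := ZMod.valMinAbs_inj.1 (Int.cast_injective hi)
    exact ((ZMod.intCast_eq_intCast_iff_dvd_sub _ _ _).1 this.symm)
  obtain ⟨j, hj⟩ := h''.choice
  exact ⟨(j : HInt), Germ.coe_eq.2 hj⟩

end ScaledZMod

section StandardPart

open ArchimedeanClass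

variable (a : ℝ*) (ω : HNat)

/-- The subgroup of finite elements of `(1/a) ℤ_ω`. -/
def finElements : AddSubgroup (ScaledZMod a ω) where
  carrier := {x | 0 ≤ ArchimedeanClass.mk x.val}
  zero_mem' := by simp [ScaledZMod.val_zero]
  add_mem' {x y} (hx : 0 ≤ ArchimedeanClass.mk x.val) (hy : 0 ≤ ArchimedeanClass.mk y.val) :=
    ((le_min hx hy).trans (min_le_mk_add _ _)).trans
      (mk_le_mk_of_abs (ScaledZMod.abs_val_add_le x y))
  neg_mem' {x} (hx : 0 ≤ ArchimedeanClass.mk x.val) := hx.trans (mk_le_mk_of_abs (ScaledZMod.abs_val_neg x).le)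

/-- The distance of a finite element of `(1/a) ℤ_ω` to `0`, up to infinitesimals. -/
def finSeminorm : AddGroupSeminorm (finElements a ω) where
  toFun x := stdPart |x.1.val|
  map_zero' := by simp [ScaledZMod.val_zero]
  add_le' x y := by
    have hx : 0 ≤ ArchimedeanClass.mk |x.1.val| := by rw [mk_abs]; exact x.2
    have hy : 0 ≤ ArchimedeanClass.mk |y.1.val| := by rw [mk_abs]; exact y.2
    have hxy : 0 ≤ ArchimedeanClass.mk |(x + y).1.val| := by rw [mk_abs]; exact (x + y).2
    rw [← stdPart_add hx hy]
    exact stdPart_monotoneOn hxy ((le_min hx hy).trans (min_le_mk_add _ _))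
      ((ScaledZMod.abs_val_add_le x.1 y.1).trans (abs_add_le _ _))
  neg' x := congrArg stdPart (ScaledZMod.abs_val_neg x.1)

/-- Finite elements carry the topology in which `x` is close to `y` when the standard part of the
distance of `x - y` to `0` is small. -/
instance : SeminormedAddCommGroup (finElements a ω) :=
  (finSeminorm a ω).toSeminormedAddCommGroup

/-- The subgroup of infinitesimal elements of `(1/a) ℤ_ω`. -/
def infinitesimals : AddSubgroup (finElements a ω) where
  carrier := {x | 0 < ArchimedeanClass.mk x.1.val}
  zero_mem' := by simp [ScaledZMod.val_zero]
  add_mem' {x y} (hx : 0 < ArchimedeanClass.mk x.1.val)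
      (hy : 0 < ArchimedeanClass.mk y.1.val) :=
    ((lt_min hx hy).trans_le (min_le_mk_add _ _)).trans_le
      (mk_le_mk_of_abs (ScaledZMod.abs_val_add_le x.1 y.1))
  neg_mem' {x} (hx : 0 < ArchimedeanClass.mk x.1.val) := hx.trans_le (mk_le_mk_of_abs (ScaledZMod.abs_val_neg x.1).le)

/-- The standard part of the finite elements of `(1/a) ℤ_ω`: the quotient of the group of finite
elements by the infinitesimals, with the quotient topology. -/
abbrev StdGroup : Type := finElements a ω ⧸ infinitesimals a ω

/-- The class `st x` of a finite element. -/
def stdClass {a : ℝ*} {ω : HNat} (x : finElements a ω) : StdGroup a ω := QuotientAddGroup.mk x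

end StandardPart

/-! ### Internal families and states -/

namespace StarHilb

/-- An internal family, indexed by the non-standard integers, of morphisms `A ⟶ B`. -/
def InternalFamily (A B : StarHilb) : Type :=
  (hyperfilter ℕ : Filter ℕ).Product fun n => ℤ → (A.space n →ₗ[ℂ] B.space n)

namespace InternalFamily

variable {A B : StarHilb}

/-- The member of an internal family with index `m`. -/
def app (F : InternalFamily A B) (m : HInt) : A ⟶ B :=
  Quotient.map₂ (sa := productSetoid _ _) (sb := germSetoid _ _) (sc := productSetoid _ _)
    (fun (f : ∀ n, ℤ → (A.space n →ₗ[ℂ] B.space n)) k n => f n (k n))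
    (fun _ _ h _ _ h' => (Eventually.and h h').mono fun _ hn => congr hn.1 hn.2) F m

/-- The internal family with members `exp (2 π i x m) • F m`. -/
def twist (x : ℝ*) (F : InternalFamily A B) : InternalFamily A B :=
  Quotient.map₂ (sa := germSetoid _ _) (sb := productSetoid _ _) (sc := productSetoid _ _)
    (fun (r : ℕ → ℝ) (f : ∀ n, ℤ → (A.space n →ₗ[ℂ] B.space n)) n m =>
      Complex.exp (2 * Real.pi * Complex.I * (r n * m)) • f n m)
    (fun _ _ h _ _ h' => (Eventually.and h h').mono fun n hn => by
      funext m; simp only [hn.1, hn.2]) x F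

/-- The hyperfinite sum of an internal family over the balanced integers modulo `ω`. -/
def balancedSum (ω : HNat) (F : InternalFamily A B) : A ⟶ B :=
  Quotient.map₂ (sa := germSetoid _ _) (sb := productSetoid _ _) (sc := productSetoid _ _)
    (fun (w : ℕ → ℕ) (f : ∀ n, ℤ → (A.space n →ₗ[ℂ] B.space n)) n =>
      ∑ m ∈ Finset.Icc (-(((w n : ℤ) - 1) / 2)) ((w n : ℤ) / 2), f n m)
    (fun _ _ h _ _ h' => (Eventually.and h h').mono fun n hn => by
      simp only [hn.1, hn.2]) ω F

end InternalFamily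

/-- The non-standard complex number given by an endomorphism of the tensor unit. -/
def toScalar (s : 𝟙_ StarHilb ⟶ 𝟙_ StarHilb) : HComplex :=
  Quotient.map' (s₁ := productSetoid _ _) (s₂ := germSetoid _ _)
    (fun (f : ℕ → (ℂ →ₗ[ℂ] ℂ)) n => f n 1) (fun _ _ h => h.mono fun _ hn =>
      congrArg (fun g : ℂ →ₗ[ℂ] ℂ => g 1) hn) s

/-- The braket `⟨φ|ψ⟩` of two states. -/
def braket {G : StarHilb} (φ ψ : 𝟙_ StarHilb ⟶ G) : HComplex :=
  toScalar (ψ ≫ dagger φ)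

end StarHilb

open StarHilb

/-! ### Quantum observables -/

/-- A `†`-Frobenius algebra: a monoid which together with its adjoint comonoid satisfies the
Frobenius law. -/
structure DaggerFrobenius (G : StarHilb) extends MonObj G where
  frobenius_left : (G ◁ dagger mul) ≫ (α_ G G G).inv ≫ (mul ▷ G) = mul ≫ dagger mul
  frobenius_right : (dagger mul ▷ G) ≫ (α_ G G G).hom ≫ (G ◁ mul) = mul ≫ dagger mul

namespace DaggerFrobenius

variable {G : StarHilb} (Z : DaggerFrobenius G)

/-- The comultiplication. -/
def comul : G ⟶ G ⊗ G := dagger Z.mul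

/-- The counit. -/
def counit : G ⟶ 𝟙_ StarHilb := dagger Z.one

/-- The comultiplication is an isometry. -/
def IsSpecial : Prop := Z.comul ≫ Z.mul = 𝟙 G

/-- The comultiplication is an isometry up to an invertible scalar. -/
def IsQuasiSpecial : Prop :=
  ∃ ξ : 𝟙_ StarHilb ≅ 𝟙_ StarHilb,
    Z.comul ≫ Z.mul = (λ_ G).inv ≫ ((ξ.hom ≫ dagger ξ.hom) ▷ G) ≫ (λ_ G).hom

/-- Commutativity. -/
def IsCommutative : Prop := (β_ G G).hom ≫ Z.mul = Z.mul

/-- The map `G ⊗ G ⟶ 𝟙` induced by the algebra. -/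
def cap : G ⊗ G ⟶ 𝟙_ StarHilb := Z.mul ≫ Z.counit

/-- The map `𝟙 ⟶ G ⊗ G` induced by the algebra. -/
def cup : 𝟙_ StarHilb ⟶ G ⊗ G := Z.one ≫ Z.comul

/-- The algebra induces a symmetric cup and cap. -/
def IsSymmetric : Prop := (β_ G G).hom ≫ Z.cap = Z.cap ∧ Z.cup ≫ (β_ G G).hom = Z.cup

/-- A quantum observable: a quasi-special symmetric `†`-Frobenius algebra. -/
def IsObservable : Prop := Z.IsQuasiSpecial ∧ Z.IsSymmetric

/-- The product of two states. -/
def mulStates (φ ψ : 𝟙_ StarHilb ⟶ G) : 𝟙_ StarHilb ⟶ G :=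
  (λ_ (𝟙_ StarHilb)).inv ≫ (φ ⊗ₘ ψ) ≫ Z.mul

/-- The classical states: those which are copied, deleted, and self-conjugate. -/
def classicalStates : Set (𝟙_ StarHilb ⟶ G) :=
  {ψ | ψ ≫ Z.comul = (λ_ (𝟙_ StarHilb)).inv ≫ (ψ ⊗ₘ ψ) ∧
    ψ ≫ Z.counit = 𝟙 (𝟙_ StarHilb) ∧
    (λ_ G).inv ≫ (ψ ▷ G) ≫ Z.cap = dagger ψ}

end DaggerFrobenius

/-- A pair of interacting (strongly complementary) quantum observables. -/
structure InteractingPair (G : StarHilb) where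
  Z : DaggerFrobenius G
  X : DaggerFrobenius G
  observable_Z : Z.IsObservable
  observable_X : X.IsObservable
  bialgebra : X.mul ≫ Z.comul = (Z.comul ⊗ₘ Z.comul) ≫ tensorμ G G G G ≫ (X.mul ⊗ₘ X.mul)
  coherence_mul : X.mul ≫ Z.counit = (Z.counit ⊗ₘ Z.counit) ≫ (λ_ (𝟙_ StarHilb)).hom
  coherence_unit : X.one ≫ Z.comul = (λ_ (𝟙_ StarHilb)).inv ≫ (X.one ⊗ₘ X.one)
  bone : X.one ≫ Z.counit = 𝟙 (𝟙_ StarHilb)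
  /-- The antipode, which bends a wire with the cup of `X` and the cap of `Z`, is self-adjoint. -/
  antipode_selfAdjoint :
    dagger ((ρ_ G).inv ≫ (G ◁ X.cup) ≫ (α_ G G G).inv ≫ (Z.cap ▷ G) ≫ (λ_ G).hom) =
      (ρ_ G).inv ≫ (G ◁ X.cup) ≫ (α_ G G G).inv ≫ (Z.cap ▷ G) ≫ (λ_ G).hom

/-- `f` is a bijection from the group `A` onto the set `S` of states, which takes the addition of
`A` to the multiplication of states by `M` and zero to the unit of `M`. -/
structure IsStateGroupIso {A : Type} [AddCommGroup A] {G : StarHilb} (M : DaggerFrobenius G)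
    (S : Set (𝟙_ StarHilb ⟶ G)) (f : A → (𝟙_ StarHilb ⟶ G)) : Prop where
  bijOn : Set.BijOn f Set.univ S
  map_zero : f 0 = M.one
  map_add : ∀ x y : A, f (x + y) = M.mulStates (f x) (f y)

/-- A quantum clock: interacting quantum observables `(Z, X)` with `Z` special and commutative, and
an (internal) isomorphism of the group of classical states of `Z` under `X` with `(1/ωuv) ℤ_ω`. -/
structure QuantumClock where
  obj : StarHilb
  pair : InteractingPair obj
  special : pair.Z.IsSpecial
  commutative : pair.Z.IsCommutative
  ωuv : ℝ*
  ωir : ℝ*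
  ω : HNat
  ωuv_pos : 0 < ωuv
  ωir_pos : 0 < ωir
  ωuv_not_infinitesimal : ¬ 0 < ArchimedeanClass.mk ωuv
  ωir_not_infinitesimal : ¬ 0 < ArchimedeanClass.mk ωir
  ω_eq : ωuv * ωir = ω.toReal
  /-- The time state `|t⟩`. -/
  timeState : ScaledZMod ωuv ω → (𝟙_ StarHilb ⟶ obj)
  timeState_iso : IsStateGroupIso pair.X pair.Z.classicalStates timeState
  /-- The internal family `m ↦ |m / ωuv⟩`. -/
  timeFamily : InternalFamily (𝟙_ StarHilb) obj
  timeFamily_app : ∀ m : HInt, timeFamily.app m = timeState (ScaledZMod.mk ωuv ω m)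

namespace QuantumClock

variable (C : QuantumClock)

/-- The plane-wave state `|E⟩`, the sum of the `exp (2 π i E t) |t⟩` over `t ∈ (1/ωuv) ℤ_ω`, where
`t = m / ωuv` with `m` balanced. -/
def planeWave (E : ScaledZMod C.ωir C.ω) : 𝟙_ StarHilb ⟶ C.obj :=
  (C.timeFamily.twist (E.val / C.ωuv)).balancedSum C.ω

/-- The standard time-translation group. -/
abbrev StdTime : Type := StdGroup C.ωuv C.ω

/-- The standard part of the finite elements of `(1/ωir) ℤ_ω`. -/
abbrev StdEnergy : Type := StdGroup C.ωir C.ω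

end QuantumClock

/-! ### Quantum dynamical systems -/

/-- A quantum dynamical system with time-translation group `G`: a strongly continuous unitary
representation of `G` on a Hilbert space. -/
structure QuantumDynamicalSystem (G : Type v) [AddCommGroup G] [TopologicalSpace G] where
  space : Type u
  [normed : NormedAddCommGroup space]
  [inner : InnerProductSpace ℂ space]
  [complete : CompleteSpace space]
  U : Multiplicative G →* unitary (space →L[ℂ] space)
  continuous_U : ∀ ψ : space,
    Continuous fun t : G => (U (Multiplicative.ofAdd t) : space →L[ℂ] space) ψ

attribute [instance] QuantumDynamicalSystem.normed QuantumDynamicalSystem.inner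
  QuantumDynamicalSystem.complete

/-- The possible values for energy, each given by the phases `t ↦ c t` that energy eigenstates with
that energy acquire under time-translation by `t`. -/
def energyPhases (G : Type v) [AddCommGroup G] [TopologicalSpace G] : Set (G → ℂ) :=
  {c | ∃ (S : QuantumDynamicalSystem.{u, v} G) (ψ : S.space), ψ ≠ 0 ∧
    ∀ t : G, (S.U (Multiplicative.ofAdd t) : S.space →L[ℂ] S.space) ψ = c t • ψ}

end

/-! ### Commutative special `†`-Frobenius algebras on finite-dimensional Hilbert spaces -/

section Frobenius

variable {H : Type*} [NormedAddCommGroup H] [InnerProductSpace ℂ H] [FiniteDimensional ℂ H]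

/-! On an energy eigenvector, time translation acts by a scalar function of `t`. Unitarity puts it
on the circle, the group law makes it multiplicative and strong continuity makes it continuous.
Conversely, every character acts on a one-dimensional space. This gives `bijOn_energyPhases`.

The claims on states reduce to finite-dimensional algebra, because an equation between internal
morphisms holds exactly when almost all of its components hold. On almost every component the
classical vectors of `Z` form an orthonormal basis indexed by a cyclic group `ℤ/w`: speciality gives
orthonormality, and simultaneous diagonalisation of the multiplication operators gives spanning
(`span_classical`). In coefficients for this basis `Z` multiplies pointwise, while `X` copies a
vector exactly when its coefficient function is multiplicative. So the classical vectors of `X` are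
the characters of `ℤ/w`, that is, the plane waves (`exists_planeWave_eq`). `nonempty_components`
supplies the components of a clock.

For the duality let `a = ωuv` and `b = ωir`. The standard parts of the finite `n / a`, with `n` not
reduced modulo `ω`, form a closed subgroup `stdLattice a` of `ℝ`, of which the time group is a
quotient. Since `a b = ω`, a change of representatives alters a product of energy and time by a
non-standard integer, so the phase can be computed without reduction (`finPairing_finMk`). A
character of the time group thus pulls back to some `x ↦ exp (2 π i θ x)`, and its triviality at `ω
/ a = b`, when `b` is finite, makes `-θ` the standard part of some `s / b`. An explicit test time
gives injectivity. The open mapping theorem for σ-compact groups upgrades the bijection to a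
homeomorphism. -/

/-- The vectors which are copied, deleted and self-conjugate for a multiplication `m` with
unit `e`. -/
structure IsClassicalVector (m : H ⊗[ℂ] H →ₗ[ℂ] H) (e v : H) : Prop where
  copied : LinearMap.adjoint m v = v ⊗ₜ[ℂ] v
  deleted : inner ℂ e v = 1
  selfConj : ∀ x, inner ℂ e (m (v ⊗ₜ[ℂ] x)) = inner ℂ v x

/-- A commutative special `†`-Frobenius algebra. -/
structure IsCommSpecialFrobenius (m : H ⊗[ℂ] H →ₗ[ℂ] H) (e : H) : Prop where
  assoc : ∀ x y z, m (m (x ⊗ₜ[ℂ] y) ⊗ₜ[ℂ] z) = m (x ⊗ₜ[ℂ] m (y ⊗ₜ[ℂ] z))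
  comm : ∀ x y, m (x ⊗ₜ[ℂ] y) = m (y ⊗ₜ[ℂ] x)
  one_mul : ∀ x, m (e ⊗ₜ[ℂ] x) = x
  special : ∀ x, m (LinearMap.adjoint m x) = x
  frobenius : ∀ x y, m.lTensor H (TensorProduct.assoc ℂ H H H (LinearMap.adjoint m x ⊗ₜ[ℂ] y)) =
    LinearMap.adjoint m (m (x ⊗ₜ[ℂ] y))

variable {m : H ⊗[ℂ] H →ₗ[ℂ] H} {e : H}

theorem adjoint_apply_eq_tmul_iff {v x y : H} : LinearMap.adjoint m v = x ⊗ₜ[ℂ] y ↔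
    ∀ a b, inner ℂ (m (a ⊗ₜ[ℂ] b)) v = inner ℂ a x * inner ℂ b y := by
  rw [TensorProduct.ext_iff_inner_left]
  simp only [LinearMap.adjoint_inner_right, TensorProduct.inner_tmul]

theorem IsClassicalVector.inner_mul {v : H} (hv : IsClassicalVector m e v) (a b : H) :
    inner ℂ (m (a ⊗ₜ[ℂ] b)) v = inner ℂ a v * inner ℂ b v :=
  adjoint_apply_eq_tmul_iff.1 hv.copied a b

namespace IsCommSpecialFrobenius

variable (hm : IsCommSpecialFrobenius m e)
include hm

/-- The adjoint of a multiplication operator is a multiplication operator. -/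
theorem exists_star (a : H) :
    ∃ b, ∀ x y, inner ℂ (m (a ⊗ₜ[ℂ] x)) y = inner ℂ x (m (b ⊗ₜ[ℂ] y)) := by
  -- Contract the first factor with `⟨a|`. The witness is `φ (m† e)`: by the Frobenius law for `m†
  -- (m (e ⊗ y))`, contracting `m† y` is multiplying `y` by it.
  let φ : H ⊗[ℂ] H →ₗ[ℂ] H :=
    (TensorProduct.lid ℂ H).toLinearMap ∘ₗ (innerₛₗ ℂ a).rTensor H
  have hφ : ∀ x w, inner ℂ (a ⊗ₜ[ℂ] x) w = inner ℂ x (φ w) := by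
    intro x w
    induction w with
    | zero => simp
    | add p q hp hq => rw [inner_add_right, hp, hq, map_add, inner_add_right]
    | tmul p q => simp [φ]
  have hφ' : ∀ w y, φ (m.lTensor H (TensorProduct.assoc ℂ H H H (w ⊗ₜ[ℂ] y))) =
      m (φ w ⊗ₜ[ℂ] y) := by
    intro w y
    induction w with
    | zero => simp
    | add p q hp hq => simp only [TensorProduct.add_tmul, map_add, hp, hq]
    | tmul p q => simp [φ, ← TensorProduct.smul_tmul']
  refine ⟨φ (LinearMap.adjoint m e), fun x y => ?_⟩
  rw [← LinearMap.adjoint_inner_right, hφ, ← hφ', hm.frobenius, hm.one_mul]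

/-- Speciality gives `v = m (v ⊗ v)`, and `w` is copied, so `⟨v, w⟩` equals its own square. -/
theorem inner_eq_zero_or_one {v w : H} (hv : IsClassicalVector m e v)
    (hw : IsClassicalVector m e w) : inner ℂ v w = (0 : ℂ) ∨ inner ℂ v w = (1 : ℂ) := by
  have h : inner ℂ v w = inner ℂ v w * (inner ℂ v w : ℂ) := by
    conv_lhs => rw [← hm.special v, hv.copied, hw.inner_mul]
  by_cases h0 : inner ℂ v w = (0 : ℂ)
  · exact Or.inl h0
  · exact Or.inr (mul_left_cancel₀ h0 (by rw [← h, mul_one]))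

theorem inner_self {v : H} (hv : IsClassicalVector m e v) : inner ℂ v v = (1 : ℂ) := by
  refine (hm.inner_eq_zero_or_one hv hv).resolve_left fun h => ?_
  have h1 := hv.deleted
  rw [inner_self_eq_zero.1 h, inner_zero_right] at h1
  exact zero_ne_one h1

/-- If the inner product were one, then `‖v - w‖² = 1 - 1 - 1 + 1 = 0`. -/
theorem inner_eq_zero {v w : H} (hv : IsClassicalVector m e v)
    (hw : IsClassicalVector m e w) (hvw : v ≠ w) : inner ℂ v w = (0 : ℂ) := by
  refine (hm.inner_eq_zero_or_one hv hw).resolve_right fun h => hvw ?_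
  have h' : inner ℂ w v = (1 : ℂ) := by rw [← inner_conj_symm, h, map_one]
  rw [← sub_eq_zero, ← inner_self_eq_zero (𝕜 := ℂ), inner_sub_left, inner_sub_right,
    inner_sub_right, hm.inner_self hv, hm.inner_self hw, h, h']
  simp

/-- A joint eigenvector of the multiplication operators is a multiple of a classical vector. -/
theorem exists_smul_classical {v : H} (hv : v ≠ 0) {χ : H → ℂ}
    (hχ : ∀ a, m (a ⊗ₜ[ℂ] v) = χ a • v) : ∃ c : ℂ, ∃ w, IsClassicalVector m e w ∧ v = c • w := by
  have hvv : inner ℂ v v ≠ (0 : ℂ) := inner_self_ne_zero.2 hv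
  have hstar : ∀ a b, (∀ x y, inner ℂ (m (a ⊗ₜ[ℂ] x)) y = inner ℂ x (m (b ⊗ₜ[ℂ] y))) →
      starRingEnd ℂ (χ a) = χ b := by
    intro a b h
    have := h v v
    rw [hχ, hχ, inner_smul_left, inner_smul_right] at this
    exact mul_right_cancel₀ hvv this
  -- Moving the multiplication operator across the inner product makes `v` an eigenvector of its
  -- adjoint. With `x = e` this determines `v` from `χ` up to the factor `⟨e, v⟩`, which cannot
  -- vanish.
  have hmul : ∀ a x, inner ℂ (m (a ⊗ₜ[ℂ] x)) v = starRingEnd ℂ (χ a) * inner ℂ x v := by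
    intro a x
    obtain ⟨b, hb⟩ := hm.exists_star a
    rw [hb, hχ, inner_smul_right, hstar a b hb]
  have hone : ∀ a, m (a ⊗ₜ[ℂ] e) = a := fun a => by rw [hm.comm, hm.one_mul]
  have hf : ∀ a, inner ℂ a v = starRingEnd ℂ (χ a) * inner ℂ e v := fun a => by
    rw [← hmul, hone]
  have hev : inner ℂ e v ≠ (0 : ℂ) := fun h => hvv (by rw [hf, h, mul_zero])
  have hχv : χ v ≠ 0 := fun h => hvv (by rw [hf, h, map_zero, zero_mul])
  have hcop : LinearMap.adjoint m v = v ⊗ₜ[ℂ] ((inner ℂ e v : ℂ)⁻¹ • v) := by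
    refine adjoint_apply_eq_tmul_iff.2 fun a b => ?_
    rw [hmul, inner_smul_right, hf a]
    field_simp
  have hev' : inner ℂ e v = χ v := by
    have h := hm.special v
    rw [hcop, TensorProduct.tmul_smul, map_smul, hχ, smul_smul] at h
    have := smul_left_injective ℂ hv (h.trans (one_smul ℂ v).symm)
    field_simp at this
    exact this.symm
  have hev'' : (inner ℂ e v : ℂ)⁻¹ * inner ℂ e v = 1 := inv_mul_cancel₀ hev
  refine ⟨inner ℂ e v, (inner ℂ e v : ℂ)⁻¹ • v, ⟨?_, ?_, fun x => ?_⟩, ?_⟩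
  · rw [map_smul, hcop, TensorProduct.smul_tmul']
  · rw [inner_smul_right, hev'']
  · rw [hm.comm, TensorProduct.tmul_smul, map_smul, hχ, smul_smul, inner_smul_right,
      inner_smul_left, ← inner_conj_symm v x, hf x, map_mul, Complex.conj_conj,
      map_inv₀, ← mul_assoc, mul_right_comm]
    have h3 : starRingEnd ℂ (inner ℂ e v : ℂ) ≠ 0 := (map_ne_zero _).2 hev
    field_simp
  · rw [smul_smul, mul_inv_cancel₀ hev, one_smul]

/-- The multiplication operators commute and are closed under adjoints, so they are simultaneously
diagonalisable; their joint eigenvectors are multiples of classical vectors. -/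
theorem span_classical : Submodule.span ℂ {v | IsClassicalVector m e v} = ⊤ := by
  let L : H →ₗ[ℂ] H →ₗ[ℂ] H := TensorProduct.curry m
  have hL : ∀ a x, L a x = m (a ⊗ₜ[ℂ] x) := fun a x => rfl
  have hadj : ∀ a, ∃ b, LinearMap.adjoint (L a) = L b := fun a => by
    obtain ⟨b, hb⟩ := hm.exists_star a
    refine ⟨b, ((LinearMap.eq_adjoint_iff _ _).2 fun x y => ?_).symm⟩
    rw [← inner_conj_symm, hL, ← hb, inner_conj_symm, hL]
  have hcomm : ∀ a b, Commute (L a) (L b) := fun a b => LinearMap.ext fun x => by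
    change L a (L b x) = L b (L a x)
    rw [hL, hL, hL, hL, ← hm.assoc, hm.comm a b, hm.assoc]
  let T : H → H →ₗ[ℂ] H := fun a => L a + LinearMap.adjoint (L a)
  have hT : ∀ a, (T a).IsSymmetric := fun a x y => by
    simp only [T, LinearMap.add_apply, inner_add_left, inner_add_right,
      LinearMap.adjoint_inner_left, LinearMap.adjoint_inner_right]
    ring
  have hTc : ∀ a b, Commute (T a) (T b) := fun a b => by
    obtain ⟨a', ha⟩ := hadj a
    obtain ⟨b', hb⟩ := hadj b
    simp only [T, ha, hb]
    exact ((hcomm _ _).add_left (hcomm _ _)).add_right ((hcomm _ _).add_left (hcomm _ _))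
  have key := LinearMap.IsSymmetric.iSup_iInf_eq_top_of_commute hT fun a b _ => hTc a b
  rw [eq_top_iff, ← key]
  refine iSup_le fun χ v hv => ?_
  simp only [Submodule.mem_iInf, Module.End.mem_eigenspace_iff] at hv
  by_cases hv0 : v = 0
  · rw [hv0]; exact zero_mem _
  -- `L a` is linear in `a` and its adjoint is conjugate linear, so `L a = (T a - i T (i a)) / 2`.
  have hLv : ∀ a, m (a ⊗ₜ[ℂ] v) =
      (1 / 2 * χ a - Complex.I / 2 * χ (Complex.I • a)) • v := fun a => by
    rw [sub_smul, mul_smul, mul_smul, ← hv, ← hv, ← hL]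
    simp only [T, map_smul, LinearMap.add_apply, LinearMap.smul_apply, map_smulₛₗ,
      smul_add, smul_smul, Complex.conj_I]
    have h1 : Complex.I / 2 * Complex.I = -(1 / 2) := by
      rw [div_mul_eq_mul_div, Complex.I_mul_I]; ring
    have h2 : Complex.I / 2 * -Complex.I = 1 / 2 := by
      rw [mul_neg, h1, neg_neg]
    rw [h1, h2]
    module
  obtain ⟨c, w, hw, rfl⟩ := hm.exists_smul_classical hv0 hLv
  exact Submodule.smul_mem _ _ (Submodule.subset_span hw)

end IsCommSpecialFrobenius

end Frobenius

/-! ### Plane waves on a finite cyclic group of classical vectors -/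

section PlaneWave

variable {H : Type*} [NormedAddCommGroup H] [InnerProductSpace ℂ H]

/-- The sum of the `exp (2 π i r j) • F j` over the balanced integers `j` modulo `w`. -/
noncomputable def planeWaveVector (F : ℤ → H) (w : ℕ) (r : ℝ) : H :=
  ∑ j ∈ Finset.Icc (-(((w : ℤ) - 1) / 2)) ((w : ℤ) / 2),
    Complex.exp (2 * Real.pi * Complex.I * (r * j)) • F j

variable [FiniteDimensional ℂ H]

/-- The vectors `F j` are the classical vectors of `(m, e)`, and `F j` depends on `j` modulo `w`;
they form a cyclic group under `x`. -/
structure IsCyclicClassical (m : H ⊗[ℂ] H →ₗ[ℂ] H) (e : H) (x : H ⊗[ℂ] H →ₗ[ℂ] H)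
    (F : ℤ → H) (w : ℕ) : Prop where
  frob : IsCommSpecialFrobenius m e
  pos : 0 < w
  classical : ∀ v, IsClassicalVector m e v ↔ ∃ j, F j = v
  eq_iff : ∀ j k, F j = F k ↔ (w : ℤ) ∣ j - k
  mul : ∀ j k, x (F j ⊗ₜ[ℂ] F k) = F (j + k)

namespace IsCyclicClassical

variable {m : H ⊗[ℂ] H →ₗ[ℂ] H} {e : H} {x : H ⊗[ℂ] H →ₗ[ℂ] H} {F : ℤ → H} {w : ℕ}
  (h : IsCyclicClassical m e x F w)
include h

theorem isClassical (j : ℤ) : IsClassicalVector m e (F j) := (h.classical _).2 ⟨j, rfl⟩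

open Classical in
theorem inner_F (j k : ℤ) : inner ℂ (F j) (F k) = if (w : ℤ) ∣ j - k then (1 : ℂ) else 0 := by
  split_ifs with hd
  · rw [(h.eq_iff j k).2 hd, h.frob.inner_self (h.isClassical k)]
  · exact h.frob.inner_eq_zero (h.isClassical j) (h.isClassical k) fun hjk =>
      hd ((h.eq_iff j k).1 hjk)

theorem span_F : Submodule.span ℂ (Set.range F) = ⊤ := by
  rw [← h.frob.span_classical]
  congr 1
  ext v
  exact (h.classical v).symm

theorem ext_inner {v v' : H} (hv : ∀ j, inner ℂ (F j) v = (inner ℂ (F j) v' : ℂ)) : v = v' := by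
  refine ext_inner_left ℂ fun y => ?_
  have hy : y ∈ Submodule.span ℂ (Set.range F) := h.span_F ▸ Submodule.mem_top
  induction hy using Submodule.span_induction with
  | mem y hy => obtain ⟨j, rfl⟩ := hy; exact hv j
  | zero => simp
  | add y z _ _ hy hz => rw [inner_add_left, inner_add_left, hy, hz]
  | smul c y _ hy => rw [inner_smul_left, inner_smul_left, hy]

theorem linearMap_ext {f g : H →ₗ[ℂ] ℂ} (hfg : ∀ j, f (F j) = g (F j)) : f = g :=
  LinearMap.ext_on_range h.span_F hfg

theorem dvd_sub_iff_of_mem {j k : ℤ}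
    (hj : j ∈ Finset.Icc (-(((w : ℤ) - 1) / 2)) ((w : ℤ) / 2))
    (hk : k ∈ Finset.Icc (-(((w : ℤ) - 1) / 2)) ((w : ℤ) / 2)) : (w : ℤ) ∣ j - k ↔ j = k := by
  constructor
  · intro hd
    rw [Finset.mem_Icc] at hj hk
    have := h.pos
    rw [← sub_eq_zero]
    exact Int.eq_zero_of_abs_lt_dvd hd (by rw [abs_lt]; omega)
  · rintro rfl; simp

/-- By orthonormality only the term at `j` survives. For general `r` the phase is not periodic
modulo `w`, hence the restriction to balanced `j`. -/
theorem inner_planeWave_of_mem (r : ℝ) {j : ℤ}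
    (hj : j ∈ Finset.Icc (-(((w : ℤ) - 1) / 2)) ((w : ℤ) / 2)) :
    inner ℂ (F j) (planeWaveVector F w r) =
      Complex.exp (2 * Real.pi * Complex.I * (r * j)) := by
  classical
  rw [planeWaveVector, inner_sum, Finset.sum_eq_single j]
  · rw [inner_smul_right, h.inner_F, if_pos (by simp), mul_one]
  · intro k hk hkj
    rw [inner_smul_right, h.inner_F, if_neg, mul_zero]
    rw [h.dvd_sub_iff_of_mem hj hk]
    exact hkj.symm
  · exact fun h' => (h' hj).elim

theorem exists_mem_dvd_sub (j : ℤ) :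
    ∃ k ∈ Finset.Icc (-(((w : ℤ) - 1) / 2)) ((w : ℤ) / 2), (w : ℤ) ∣ j - k := by
  have : NeZero w := ⟨h.pos.ne'⟩
  refine ⟨(j : ZMod w).valMinAbs, ?_, ?_⟩
  · have := (j : ZMod w).valMinAbs_mem_Ioc
    rw [Set.mem_Ioc] at this
    rw [Finset.mem_Icc]
    omega
  · rw [← ZMod.intCast_eq_intCast_iff_dvd_sub, ZMod.coe_valMinAbs]

theorem exp_eq_exp_of_dvd {a b : ℤ} (hd : (w : ℤ) ∣ a - b) :
    Complex.exp (2 * Real.pi * Complex.I * (a / w)) =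
      Complex.exp (2 * Real.pi * Complex.I * (b / w)) := by
  obtain ⟨c, hc⟩ := hd
  obtain rfl : a = b + w * c := by omega
  refine Complex.exp_eq_exp_iff_exists_int.2 ⟨c, ?_⟩
  have : (w : ℂ) ≠ 0 := Nat.cast_ne_zero.2 h.pos.ne'
  push_cast
  field_simp

/-- At frequency `k / w` the phase depends only on `j` modulo `w`, so `j` may be replaced by its
balanced residue. -/
theorem inner_planeWave (k j : ℤ) :
    inner ℂ (F j) (planeWaveVector F w (k / w)) =
      Complex.exp (2 * Real.pi * Complex.I * ((k * j : ℤ) / w)) := by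
  obtain ⟨j', hj', hd⟩ := h.exists_mem_dvd_sub j
  rw [(h.eq_iff j j').2 hd, h.inner_planeWave_of_mem _ hj',
    h.exp_eq_exp_of_dvd (a := k * j) (b := k * j') (by rw [← mul_sub]; exact hd.mul_left k)]
  congr 1
  push_cast
  ring

theorem planeWave_eq_iff (k k' : ℤ) :
    planeWaveVector F w (k / w) = planeWaveVector F w (k' / w) ↔ (w : ℤ) ∣ k - k' := by
  constructor
  · intro hk
    -- The coefficient at `1` alone recovers `k` modulo `w`.
    have h1 := h.inner_planeWave k 1
    rw [hk, h.inner_planeWave, mul_one, mul_one, Complex.exp_eq_exp_iff_exists_int] at h1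
    obtain ⟨n, hn⟩ := h1
    refine ⟨-n, ?_⟩
    have hw : (w : ℂ) ≠ 0 := Nat.cast_ne_zero.2 h.pos.ne'
    field_simp at hn
    have h2 : (k' : ℂ) = k + w * n := by
      have := mul_left_cancel₀ (Complex.two_pi_I_ne_zero) (by
        rw [hn] : 2 * Real.pi * Complex.I * (k' : ℂ) = 2 * Real.pi * Complex.I * (k + w * n))
      exact this
    have h3 : k' = k + w * n := by exact_mod_cast h2
    rw [h3]; ring
  · intro hd
    refine h.ext_inner fun j => ?_
    rw [h.inner_planeWave, h.inner_planeWave]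
    exact h.exp_eq_exp_of_dvd (by rw [← sub_mul]; exact hd.mul_right j)

theorem planeWave_zero : planeWaveVector F w 0 = e := by
  refine h.ext_inner fun j => ?_
  have := h.inner_planeWave 0 j
  simp only [Int.cast_zero, zero_div, zero_mul, mul_zero, Complex.exp_zero] at this
  rw [this, ← inner_conj_symm, (h.isClassical j).deleted, map_one]

/-- The `F j` are copied, so `m` multiplies coefficients pointwise. -/
theorem mul_planeWave (k k' : ℤ) :
    m (planeWaveVector F w (k / w) ⊗ₜ[ℂ] planeWaveVector F w (k' / w)) =
      planeWaveVector F w ((k + k' : ℤ) / w) := by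
  refine h.ext_inner fun j => ?_
  rw [← inner_conj_symm, (h.isClassical j).inner_mul, map_mul, inner_conj_symm, inner_conj_symm,
    h.inner_planeWave, h.inner_planeWave, h.inner_planeWave, ← Complex.exp_add]
  congr 1
  push_cast
  ring

/-- For `v = F j` both sides test whether `w` divides `j + k`. This computes the cap of `x`, as
needed for self-conjugacy. -/
theorem inner_mul_F (v : H) (k : ℤ) :
    inner ℂ (F 0) (x (v ⊗ₜ[ℂ] F k)) = (inner ℂ (F (-k)) v : ℂ) := by
  classical
  have : (innerₛₗ ℂ (F 0)) ∘ₗ x ∘ₗ (TensorProduct.mk ℂ H H).flip (F k) = innerₛₗ ℂ (F (-k)) :=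
    h.linearMap_ext fun j => by
      simp only [LinearMap.comp_apply, LinearMap.flip_apply, TensorProduct.mk_apply,
        innerₛₗ_apply_apply, h.mul, h.inner_F]
      congr 2
      ring
  exact LinearMap.congr_fun this v

/-- Copying is tested on the spanning vectors `F j ⊗ F k`, which `x` sends to `F (j + k)`. -/
theorem adjoint_eq_tmul_iff (v : H) : LinearMap.adjoint x v = v ⊗ₜ[ℂ] v ↔
    ∀ j k, inner ℂ (F (j + k)) v = inner ℂ (F j) v * (inner ℂ (F k) v : ℂ) := by
  rw [adjoint_apply_eq_tmul_iff]
  constructor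
  · intro hv j k
    rw [← h.mul, hv]
  · intro hv a b
    have ha : a ∈ Submodule.span ℂ (Set.range F) := h.span_F ▸ Submodule.mem_top
    have hb : b ∈ Submodule.span ℂ (Set.range F) := h.span_F ▸ Submodule.mem_top
    induction ha using Submodule.span_induction with
    | mem y hy =>
      obtain ⟨j, rfl⟩ := hy
      induction hb using Submodule.span_induction with
      | mem y hy => obtain ⟨k, rfl⟩ := hy; rw [h.mul, hv]
      | zero => simp
      | add y z _ _ hy hz =>
        rw [TensorProduct.tmul_add, map_add, inner_add_left, inner_add_left, hy, hz, mul_add]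
      | smul c y _ hy =>
        rw [TensorProduct.tmul_smul, map_smul, inner_smul_left, inner_smul_left, hy]; ring
    | zero => simp
    | add y z _ _ hy hz =>
      rw [TensorProduct.add_tmul, map_add, inner_add_left, inner_add_left, hy, hz, add_mul]
    | smul c y _ hy =>
      rw [← TensorProduct.smul_tmul', map_smul, inner_smul_left, inner_smul_left, hy]; ring

theorem isClassical_planeWave (k : ℤ) :
    IsClassicalVector x (F 0) (planeWaveVector F w (k / w)) where
  copied := by
    rw [h.adjoint_eq_tmul_iff]
    intro j l
    rw [h.inner_planeWave, h.inner_planeWave, h.inner_planeWave, ← Complex.exp_add]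
    congr 1
    push_cast
    ring
  deleted := by rw [h.inner_planeWave]; simp
  selfConj y := by
    have : (innerₛₗ ℂ (F 0)) ∘ₗ x ∘ₗ TensorProduct.mk ℂ H H (planeWaveVector F w (k / w)) =
        innerₛₗ ℂ (planeWaveVector F w (k / w)) := h.linearMap_ext fun j => by
      simp only [LinearMap.comp_apply, TensorProduct.mk_apply, innerₛₗ_apply_apply]
      rw [h.inner_mul_F, ← inner_conj_symm _ (F j), h.inner_planeWave, h.inner_planeWave,
        ← Complex.exp_conj]
      congr 1
      simp only [map_mul, map_div₀, Complex.conj_ofReal, Complex.conj_I, map_intCast, map_natCast,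
        map_ofNat]
      push_cast
      ring
    exact LinearMap.congr_fun this y

/-- The coefficients of `v` are multiplicative in `j` and periodic modulo `w`. Their value at `1` is
therefore a `w`-th root of unity, which fixes the others. -/
theorem exists_planeWave_eq {v : H} (hv : IsClassicalVector x (F 0) v) :
    ∃ k : ℤ, planeWaveVector F w (k / w) = v := by
  have hadd := (h.adjoint_eq_tmul_iff v).1 hv.copied
  set f : Multiplicative ℤ →* ℂ :=
    { toFun := fun j => inner ℂ (F j.toAdd) v
      map_one' := hv.deleted
      map_mul' := fun j k => hadd j.toAdd k.toAdd } with hf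
  have hfw : f (Multiplicative.ofAdd 1) ^ w = 1 := by
    rw [← map_pow, ← ofAdd_nsmul]
    change inner ℂ (F (w • 1)) v = (1 : ℂ)
    rw [(h.eq_iff (w • 1) 0).2 (by simp), hv.deleted]
  have : NeZero w := ⟨h.pos.ne'⟩
  have hw : (w : ℂ) ≠ 0 := Nat.cast_ne_zero.2 h.pos.ne'
  obtain ⟨k, -, hk⟩ := (Complex.isPrimitiveRoot_exp w h.pos.ne').eq_pow_of_pow_eq_one hfw
  refine ⟨k, h.ext_inner fun j => ?_⟩
  have hj : inner ℂ (F j) v = f (Multiplicative.ofAdd 1 ^ j) := by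
    rw [← ofAdd_zsmul]; simp [hf]
  have hz : f (Multiplicative.ofAdd 1 ^ j) = f (Multiplicative.ofAdd 1) ^ j := by
    have h1 : IsUnit (f (Multiplicative.ofAdd 1)) := (Group.isUnit _).map f
    exact map_zpow' f (fun y => eq_inv_of_mul_eq_one_left (by rw [← map_mul]; simp)) _ _
  rw [h.inner_planeWave, hj, hz, ← hk, ← zpow_natCast, ← zpow_mul, ← Complex.exp_int_mul]
  congr 1
  push_cast
  field_simp

end IsCyclicClassical

end PlaneWave

/-! ### Transfer from internal algebras to their components -/

namespace StarHilb

theorem exists_ofSeq_eq {A B : StarHilb} (f : A ⟶ B) :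
    ∃ s : ∀ n, A.space n →ₗ[ℂ] B.space n, Hom.ofSeq s = f := Quotient.exists_rep f

end StarHilb

open StarHilb

theorem LinearMap.adjoint_apply_eq_inner {E : Type*} [NormedAddCommGroup E]
    [InnerProductSpace ℂ E] [FiniteDimensional ℂ E] (g : ℂ →ₗ[ℂ] E) (y : E) :
    LinearMap.adjoint g y = inner ℂ (g 1) y := by
  simpa using LinearMap.adjoint_inner_right g 1 y

namespace DaggerFrobenius

variable {G : StarHilb} (D : DaggerFrobenius G)
  {m : ∀ n, G.space n ⊗[ℂ] G.space n →ₗ[ℂ] G.space n} {e : ∀ n, ℂ →ₗ[ℂ] G.space n}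

theorem eventually_isCommSpecialFrobenius
    (hm : D.mul = (Hom.ofSeq (A := G ⊗ G) m : G ⊗ G ⟶ G))
    (he : D.one = (Hom.ofSeq (A := 𝟙_ StarHilb) e : 𝟙_ StarHilb ⟶ G))
    (hs : D.IsSpecial) (hc : D.IsCommutative) :
    ∀ᶠ n in (hyperfilter ℕ : Filter ℕ), IsCommSpecialFrobenius (m n) (e n 1) := by
  have h1 := D.mul_assoc
  have h2 := D.one_mul
  have h3 := D.frobenius_right
  rw [IsSpecial, comul] at hs
  rw [IsCommutative] at hc
  rw [hm] at h1 h2 h3 hs hc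
  rw [he] at h2
  have h1 := Hom.ofSeq_eq.1 h1
  have h2 := Hom.ofSeq_eq.1 h2
  have h3 := Hom.ofSeq_eq.1 h3
  have hs := Hom.ofSeq_eq.1 hs
  have hc := Hom.ofSeq_eq.1 hc
  filter_upwards [h1, h2, h3, hs, hc] with n h1 h2 h3 hs hc
  exact
    { assoc := fun x y z => LinearMap.congr_fun h1 ((x ⊗ₜ[ℂ] y) ⊗ₜ[ℂ] z)
      comm := fun x y => (LinearMap.congr_fun hc (x ⊗ₜ[ℂ] y)).symm
      one_mul := fun x => (LinearMap.congr_fun h2 ((1 : ℂ) ⊗ₜ[ℂ] x)).trans (one_smul ℂ x)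
      special := fun x => LinearMap.congr_fun hs x
      frobenius := fun x y => LinearMap.congr_fun h3 (x ⊗ₜ[ℂ] y) }

theorem ofSeq_mem_classicalStates_iff
    (hm : D.mul = (Hom.ofSeq (A := G ⊗ G) m : G ⊗ G ⟶ G))
    (he : D.one = (Hom.ofSeq (A := 𝟙_ StarHilb) e : 𝟙_ StarHilb ⟶ G))
    (f : ∀ n, ℂ →ₗ[ℂ] G.space n) :
    (Hom.ofSeq (A := 𝟙_ StarHilb) f : 𝟙_ StarHilb ⟶ G) ∈ D.classicalStates ↔
      ∀ᶠ n in (hyperfilter ℕ : Filter ℕ), IsClassicalVector (m n) (e n 1) (f n 1) := by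
  have h1 : (Hom.ofSeq (A := 𝟙_ StarHilb) f : 𝟙_ StarHilb ⟶ G) ∈ D.classicalStates ↔
      (∀ᶠ n in (hyperfilter ℕ : Filter ℕ), LinearMap.adjoint (m n) ∘ₗ f n =
        TensorProduct.map (f n) (f n) ∘ₗ (TensorProduct.lid ℂ ℂ).symm.toLinearMap) ∧
      (∀ᶠ n in (hyperfilter ℕ : Filter ℕ), LinearMap.adjoint (e n) ∘ₗ f n = LinearMap.id) ∧
      (∀ᶠ n in (hyperfilter ℕ : Filter ℕ), ((LinearMap.adjoint (e n) ∘ₗ m n) ∘ₗ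
        (f n).rTensor (G.space n)) ∘ₗ (TensorProduct.lid ℂ (G.space n)).symm.toLinearMap =
          LinearMap.adjoint (f n)) := by
    change (_ ≫ D.comul = _ ∧ _ ≫ D.counit = _ ∧ _ = _) ↔ _
    rw [comul, cap, counit, hm, he]
    exact and_congr Hom.ofSeq_eq (and_congr Hom.ofSeq_eq Hom.ofSeq_eq)
  rw [h1, ← eventually_and, ← eventually_and]
  refine eventually_congr (Eventually.of_forall fun n => ?_)
  have hadj := LinearMap.adjoint_apply_eq_inner (E := G.space n)
  constructor
  · rintro ⟨h1, h2, h3⟩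
    refine ⟨LinearMap.congr_fun h1 (1 : ℂ), ?_, fun x => ?_⟩
    · rw [← hadj]; exact LinearMap.congr_fun h2 (1 : ℂ)
    · rw [← hadj, ← hadj]; exact LinearMap.congr_fun h3 x
  · rintro ⟨h1, h2, h3⟩
    refine ⟨LinearMap.ext_ring ?_, LinearMap.ext_ring ?_, LinearMap.ext fun x => ?_⟩
    · exact h1
    · exact (hadj _ _).trans h2
    · rw [hadj, ← h3, ← hadj]; rfl

theorem mulStates_ofSeq
    (hm : D.mul = (Hom.ofSeq (A := G ⊗ G) m : G ⊗ G ⟶ G))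
    (f g k : ∀ n, ℂ →ₗ[ℂ] G.space n) :
    (Hom.ofSeq (A := 𝟙_ StarHilb) k : 𝟙_ StarHilb ⟶ G) =
        D.mulStates (Hom.ofSeq (A := 𝟙_ StarHilb) f) (Hom.ofSeq (A := 𝟙_ StarHilb) g) ↔
      ∀ᶠ n in (hyperfilter ℕ : Filter ℕ), k n 1 = m n (f n 1 ⊗ₜ[ℂ] g n 1) := by
  rw [mulStates, hm]
  refine Hom.ofSeq_eq.trans (eventually_congr (Eventually.of_forall fun n => ?_))
  constructor
  · intro h
    exact LinearMap.congr_fun h (1 : ℂ)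
  · intro h
    exact LinearMap.ext_ring h

end DaggerFrobenius

/-- A property which holds almost everywhere along every sequence holds almost everywhere for all
values at once. -/
theorem Ultrafilter.eventually_forall_of_forall_seq {ι : Type*} {α : ι → Type*}
    [∀ n, Nonempty (α n)] {l : Ultrafilter ι} {p : ∀ n, α n → Prop}
    (h : ∀ s : ∀ n, α n, ∀ᶠ n in (l : Filter ι), p n (s n)) :
    ∀ᶠ n in (l : Filter ι), ∀ a, p n a := by
  have hs : ∀ n, ∃ a, p n a → ∀ b, p n b := fun n => by
    by_cases hn : ∀ b, p n b
    · exact ⟨Classical.arbitrary _, fun _ => hn⟩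
    · obtain ⟨a, ha⟩ := not_forall.1 hn
      exact ⟨a, fun h => (ha h).elim⟩
  choose s hs using hs
  exact (h s).mono fun n hn => hs n hn

/-- Ultrafilters commute with implication, which general filters do not. -/
theorem Ultrafilter.eventually_iff {ι : Type*} {l : Ultrafilter ι} {p q : ι → Prop} :
    (∀ᶠ n in (l : Filter ι), (p n ↔ q n)) ↔
      ((∀ᶠ n in (l : Filter ι), p n) ↔ ∀ᶠ n in (l : Filter ι), q n) := by
  simp only [iff_iff_implies_and_implies, eventually_and, Ultrafilter.eventually_imp]

/-! ### Components of a quantum clock -/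

theorem ScaledZMod.mk_coe_eq_mk_coe_iff {a : ℝ*} {w : ℕ → ℕ} {s t : ℕ → ℤ} :
    ScaledZMod.mk a (w : HNat) (s : HInt) = ScaledZMod.mk a (w : HNat) (t : HInt) ↔
      ∀ᶠ n in (hyperfilter ℕ : Filter ℕ), (w n : ℤ) ∣ s n - t n := by
  rw [ScaledZMod.mk_eq_mk]
  constructor
  · rintro ⟨j, hj⟩
    induction j using Germ.inductionOn with | h j =>
    exact (Germ.coe_eq.1 hj).mono fun n hn => ⟨j n, hn⟩
  · intro h
    obtain ⟨j, hj⟩ := h.choice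
    exact ⟨(j : HInt), Germ.coe_eq.2 hj⟩

/-- Representatives of the internal structure of a quantum clock. -/
structure QuantumClock.Components (C : QuantumClock) where
  zmul : ∀ n, C.obj.space n ⊗[ℂ] C.obj.space n →ₗ[ℂ] C.obj.space n
  zone : ∀ n, ℂ →ₗ[ℂ] C.obj.space n
  xmul : ∀ n, C.obj.space n ⊗[ℂ] C.obj.space n →ₗ[ℂ] C.obj.space n
  F : ∀ n, ℤ → (ℂ →ₗ[ℂ] C.obj.space n)
  w : ℕ → ℕ
  zmul_eq : C.pair.Z.mul = (Hom.ofSeq (A := C.obj ⊗ C.obj) zmul : C.obj ⊗ C.obj ⟶ C.obj)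
  zone_eq : C.pair.Z.one = (Hom.ofSeq (A := 𝟙_ StarHilb) zone : 𝟙_ StarHilb ⟶ C.obj)
  xmul_eq : C.pair.X.mul = (Hom.ofSeq (A := C.obj ⊗ C.obj) xmul : C.obj ⊗ C.obj ⟶ C.obj)
  xone_eq : C.pair.X.one =
    (Hom.ofSeq (A := 𝟙_ StarHilb) fun n => F n 0 : 𝟙_ StarHilb ⟶ C.obj)
  ω_eq : C.ω = (w : HNat)
  timeFamily_eq : C.timeFamily = Quotient.mk (productSetoid _ _) F
  timeState_eq : ∀ s : ℕ → ℤ, C.timeState (ScaledZMod.mk C.ωuv C.ω (s : HInt)) =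
    (Hom.ofSeq (A := 𝟙_ StarHilb) fun n => F n (s n) : 𝟙_ StarHilb ⟶ C.obj)
  cyclic : ∀ᶠ n in (hyperfilter ℕ : Filter ℕ),
    IsCyclicClassical (zmul n) (zone n 1) (xmul n) (fun j => F n j 1) (w n)

namespace QuantumClock

variable (C : QuantumClock)

/-- Each axiom of the clock, applied to arbitrary sequences of representatives, becomes a property
of all elements of almost every component. Internality of the time family is what represents `|t⟩`
by `F n (s n)`. -/
theorem nonempty_components : Nonempty C.Components := by
  obtain ⟨zm, hzm⟩ : ∃ f : ∀ n, C.obj.space n ⊗[ℂ] C.obj.space n →ₗ[ℂ] C.obj.space n,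
      (Hom.ofSeq (A := C.obj ⊗ C.obj) f : C.obj ⊗ C.obj ⟶ C.obj) = C.pair.Z.mul := Quotient.exists_rep C.pair.Z.mul
  obtain ⟨ze, hze⟩ : ∃ f : ∀ n, ℂ →ₗ[ℂ] C.obj.space n,
      (Hom.ofSeq (A := 𝟙_ StarHilb) f : 𝟙_ StarHilb ⟶ C.obj) = C.pair.Z.one := Quotient.exists_rep C.pair.Z.one
  obtain ⟨xm, hxm⟩ : ∃ f : ∀ n, C.obj.space n ⊗[ℂ] C.obj.space n →ₗ[ℂ] C.obj.space n,
      (Hom.ofSeq (A := C.obj ⊗ C.obj) f : C.obj ⊗ C.obj ⟶ C.obj) = C.pair.X.mul := Quotient.exists_rep C.pair.X.mul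
  obtain ⟨F, hF⟩ : ∃ F : ∀ n, ℤ → (ℂ →ₗ[ℂ] C.obj.space n),
      Quotient.mk (productSetoid _ _) F = C.timeFamily := Quotient.exists_rep _
  obtain ⟨w, hw⟩ : ∃ w : ℕ → ℕ, (w : HNat) = C.ω := Quotient.exists_rep _
  have hT : ∀ s : ℕ → ℤ, C.timeState (ScaledZMod.mk C.ωuv C.ω (s : HInt)) =
      (Hom.ofSeq (A := 𝟙_ StarHilb) fun n => F n (s n) : 𝟙_ StarHilb ⟶ C.obj) := fun s => by
    rw [← C.timeFamily_app, ← hF]; rfl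
  have hstate : ∀ {f g : ∀ n, ℂ →ₗ[ℂ] C.obj.space n},
      (Hom.ofSeq (A := 𝟙_ StarHilb) f : 𝟙_ StarHilb ⟶ C.obj) = Hom.ofSeq (A := 𝟙_ StarHilb) g ↔
      ∀ᶠ n in (hyperfilter ℕ : Filter ℕ), f n 1 = g n 1 := fun {f g} =>
    Hom.ofSeq_eq.trans (eventually_congr (Eventually.of_forall fun n =>
      ⟨fun h => LinearMap.congr_fun h (1 : ℂ), fun h => LinearMap.ext_ring h⟩))
  have iso := C.timeState_iso
  have hpos : ∀ᶠ n in (hyperfilter ℕ : Filter ℕ), 0 < w n := by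
    have h : 0 < C.ω.toReal := C.ω_eq ▸ mul_pos C.ωuv_pos C.ωir_pos
    rw [← hw] at h
    exact (Germ.coe_lt.1 h).mono fun n hn => Nat.cast_pos.1 hn
  have hcl : ∀ᶠ n in (hyperfilter ℕ : Filter ℕ), ∀ j : ℤ,
      IsClassicalVector (zm n) (ze n 1) (F n j 1) :=
    Ultrafilter.eventually_forall_of_forall_seq fun s => by
      rw [← C.pair.Z.ofSeq_mem_classicalStates_iff hzm.symm hze.symm, ← hT]
      exact iso.bijOn.mapsTo (Set.mem_univ _)
  have hsurj : ∀ᶠ n in (hyperfilter ℕ : Filter ℕ), ∀ v : C.obj.space n,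
      IsClassicalVector (zm n) (ze n 1) v → ∃ j, F n j 1 = v :=
    Ultrafilter.eventually_forall_of_forall_seq fun v => by
      rw [Ultrafilter.eventually_imp]
      intro h
      have hmem := (C.pair.Z.ofSeq_mem_classicalStates_iff hzm.symm hze.symm
        fun n => LinearMap.toSpanSingleton ℂ _ (v n)).2 (by simpa using h)
      obtain ⟨t, -, ht⟩ := iso.bijOn.surjOn hmem
      obtain ⟨s, rfl⟩ := ScaledZMod.mk_surjective t
      induction s using Germ.inductionOn with | h s =>
      rw [hT, hstate] at ht
      exact ht.mono fun n hn => ⟨s n, by simpa using hn⟩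
  have hinj : ∀ᶠ n in (hyperfilter ℕ : Filter ℕ), ∀ p : ℤ × ℤ,
      F n p.1 1 = F n p.2 1 ↔ (w n : ℤ) ∣ p.1 - p.2 :=
    Ultrafilter.eventually_forall_of_forall_seq fun p => by
      rw [Ultrafilter.eventually_iff, ← ScaledZMod.mk_coe_eq_mk_coe_iff (a := C.ωuv),
        ← hstate (f := fun n => F n (p n).1) (g := fun n => F n (p n).2), ← hT, ← hT, hw]
      exact iso.bijOn.injOn.eq_iff (Set.mem_univ _) (Set.mem_univ _)
  have hmul : ∀ᶠ n in (hyperfilter ℕ : Filter ℕ), ∀ p : ℤ × ℤ,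
      F n (p.1 + p.2) 1 = xm n (F n p.1 1 ⊗ₜ[ℂ] F n p.2 1) :=
    Ultrafilter.eventually_forall_of_forall_seq fun p => by
      refine (C.pair.X.mulStates_ofSeq hxm.symm (fun n => F n (p n).1) (fun n => F n (p n).2)
        (fun n => F n ((p n).1 + (p n).2))).1 ?_
      rw [← hT, ← hT, ← hT, ← iso.map_add, ← map_add]
      rfl
  have hfrob := C.pair.Z.eventually_isCommSpecialFrobenius hzm.symm hze.symm C.special C.commutative
  refine ⟨⟨zm, ze, xm, F, w, hzm.symm, hze.symm, hxm.symm, ?_, hw.symm, hF.symm, hT, ?_⟩⟩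
  · rw [← iso.map_zero, ← map_zero (ScaledZMod.mk C.ωuv C.ω)]
    exact hT fun _ => 0
  · filter_upwards [hpos, hcl, hsurj, hinj, hmul, hfrob] with n h1 h2 h3 h4 h5 h6
    exact ⟨h6, h1, fun v => ⟨h3 v, fun ⟨j, hj⟩ => hj ▸ h2 j⟩, fun j k => h4 (j, k),
      fun j k => (h5 (j, k)).symm⟩

namespace Components

variable {C} (K : C.Components)

/-- Since `ωuv * ωir = ω`, the frequency is an integer over `w`, where plane waves are periodic. -/
theorem planeWave_val (s : ℕ → ℤ) :
    (ScaledZMod.mk C.ωir C.ω (s : HInt)).val / C.ωuv =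
      Hyperreal.ofSeq fun n => (((s n : ZMod (K.w n)).valMinAbs : ℤ) : ℝ) / K.w n := by
  rw [ScaledZMod.val_mk, div_div, mul_comm, C.ω_eq, K.ω_eq]
  rfl

theorem val_mul_val (s t : ℕ → ℤ) :
    (ScaledZMod.mk C.ωir C.ω (s : HInt)).val * (ScaledZMod.mk C.ωuv C.ω (t : HInt)).val =
      Hyperreal.ofSeq fun n => (((s n : ZMod (K.w n)).valMinAbs : ℤ) : ℝ) *
        ((t n : ZMod (K.w n)).valMinAbs : ℤ) / K.w n := by
  rw [ScaledZMod.val_mk, ScaledZMod.val_mk, div_mul_div_comm, mul_comm C.ωir, C.ω_eq, K.ω_eq]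
  rfl

/-- Representatives of the plane wave with energy represented by `s`. -/
noncomputable def wave (s : ℕ → ℤ) (n : ℕ) : ℂ →ₗ[ℂ] C.obj.space n :=
  LinearMap.toSpanSingleton ℂ _ (planeWaveVector (fun j => K.F n j 1) (K.w n) (s n / K.w n))

theorem wave_one (s : ℕ → ℤ) (n : ℕ) :
    K.wave s n 1 = planeWaveVector (fun j => K.F n j 1) (K.w n) (s n / K.w n) := by
  simp [wave]

theorem dvd_valMinAbs_sub (w : ℕ) (s : ℤ) : (w : ℤ) ∣ (s : ZMod w).valMinAbs - s := by
  rw [← ZMod.intCast_eq_intCast_iff_dvd_sub, ZMod.coe_valMinAbs]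

theorem planeWave_mk (s : ℕ → ℤ) :
    C.planeWave (ScaledZMod.mk C.ωir C.ω (s : HInt)) =
      (Hom.ofSeq (A := 𝟙_ StarHilb) (K.wave s) : 𝟙_ StarHilb ⟶ C.obj) := by
  rw [planeWave, K.planeWave_val, K.timeFamily_eq, K.ω_eq]
  refine Hom.ofSeq_eq.2 (K.cyclic.mono fun n hn => ?_)
  refine LinearMap.ext_ring ((?_ : _ = planeWaveVector (fun j => K.F n j 1) (K.w n)
    ((((s n : ZMod (K.w n)).valMinAbs : ℤ) : ℝ) / K.w n)).trans ?_)
  · exact LinearMap.sum_apply _ _ _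
  · refine Eq.trans ?_ (K.wave_one s n).symm
    -- The definition uses the balanced residue of `s n`; congruent frequencies give the same
    -- vector.
    exact (hn.planeWave_eq_iff _ _).2 (dvd_valMinAbs_sub _ _)

theorem braket_ofSeq {G : StarHilb} (f g : ∀ n, ℂ →ₗ[ℂ] G.space n) :
    braket (Hom.ofSeq (A := 𝟙_ StarHilb) f : 𝟙_ StarHilb ⟶ G) (Hom.ofSeq (A := 𝟙_ StarHilb) g) =
      ((fun n => inner ℂ (f n 1) (g n 1) : ℕ → ℂ) : HComplex) :=
  congrArg (fun h : ℕ → ℂ => (h : HComplex))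
    (funext fun n => LinearMap.adjoint_apply_eq_inner (f n) (g n 1))

end Components

theorem braket_planeWave_timeState (E : ScaledZMod C.ωir C.ω) (t : ScaledZMod C.ωuv C.ω) :
    braket (C.planeWave E) (C.timeState t) = hyperPhase (-(E.val * t.val)) := by
  obtain ⟨K⟩ := C.nonempty_components
  obtain ⟨s, rfl⟩ := ScaledZMod.mk_surjective E
  obtain ⟨t, rfl⟩ := ScaledZMod.mk_surjective t
  induction s using Germ.inductionOn with | h s =>
  induction t using Germ.inductionOn with | h t =>
  rw [K.val_mul_val, K.planeWave_mk, K.timeState_eq, Components.braket_ofSeq]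
  refine Germ.coe_eq.2 (K.cyclic.mono fun n hn => ?_)
  change inner ℂ (K.wave s n 1) (K.F n (t n) 1) = Complex.exp (2 * Real.pi * Complex.I *
    ((-((((s n : ZMod (K.w n)).valMinAbs : ℤ) : ℝ) *
        ((t n : ZMod (K.w n)).valMinAbs : ℤ) / K.w n) : ℝ) : ℂ))
  -- The values of `E` and `t` are balanced, while the coefficient formula uses raw representatives;
  -- the products agree modulo `w`.
  have h1 := hn.exp_eq_exp_of_dvd (a := -(s n * t n))
    (b := -((s n : ZMod (K.w n)).valMinAbs * (t n : ZMod (K.w n)).valMinAbs)) (by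
      have hs := Components.dvd_valMinAbs_sub (K.w n) (s n)
      have ht := Components.dvd_valMinAbs_sub (K.w n) (t n)
      generalize (s n : ZMod (K.w n)).valMinAbs = k at hs
      generalize (t n : ZMod (K.w n)).valMinAbs = l at ht
      have : -(s n * t n) - -(k * l) = (k - s n) * l + s n * (l - t n) := by ring
      rw [this]
      exact (hs.mul_right _).add (ht.mul_left _))
  rw [K.wave_one, ← inner_conj_symm, hn.inner_planeWave, ← Complex.exp_conj]
  simp only [map_mul, map_div₀, Complex.conj_ofReal, Complex.conj_I, map_intCast, map_natCast,
        map_ofNat]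
  push_cast at h1 ⊢
  rw [← neg_div, ← h1]
  congr 1
  ring

theorem planeWave_iso :
    IsStateGroupIso C.pair.Z C.pair.X.classicalStates C.planeWave := by
  obtain ⟨K⟩ := C.nonempty_components
  have hmem := fun f => C.pair.X.ofSeq_mem_classicalStates_iff K.xmul_eq K.xone_eq f
  refine ⟨⟨?_, ?_, ?_⟩, ?_, ?_⟩
  · intro E _
    obtain ⟨s, rfl⟩ := ScaledZMod.mk_surjective E
    induction s using Germ.inductionOn with | h s =>
    rw [K.planeWave_mk, hmem]
    exact K.cyclic.mono fun n hn => K.wave_one s n ▸ hn.isClassical_planeWave (s n)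
  · intro E _ E' _ h
    obtain ⟨s, rfl⟩ := ScaledZMod.mk_surjective E
    obtain ⟨s', rfl⟩ := ScaledZMod.mk_surjective E'
    induction s using Germ.inductionOn with | h s =>
    induction s' using Germ.inductionOn with | h s' =>
    rw [K.planeWave_mk, K.planeWave_mk] at h
    have h := Hom.ofSeq_eq.1 h
    rw [K.ω_eq, ScaledZMod.mk_coe_eq_mk_coe_iff]
    filter_upwards [h, K.cyclic] with n hn hc
    rw [← hc.planeWave_eq_iff, ← K.wave_one, ← K.wave_one, hn]
  -- Almost every component of `ψ` is a plane wave; its frequencies assemble to a non-standard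
  -- integer.
  · intro ψ hψ
    obtain ⟨f, rfl⟩ : ∃ f : ∀ n, ℂ →ₗ[ℂ] C.obj.space n,
      (Hom.ofSeq (A := 𝟙_ StarHilb) f : 𝟙_ StarHilb ⟶ C.obj) = ψ := exists_ofSeq_eq ψ
    obtain ⟨s, hs⟩ : ∃ s : ℕ → ℤ, ∀ᶠ n in (hyperfilter ℕ : Filter ℕ),
        planeWaveVector (fun j => K.F n j 1) (K.w n) (s n / K.w n) = f n 1 :=
      Filter.Eventually.choice (((hmem f).1 hψ).and K.cyclic |>.mono fun n hn =>
        hn.2.exists_planeWave_eq hn.1)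
    refine ⟨ScaledZMod.mk C.ωir C.ω (s : HInt), Set.mem_univ _, ?_⟩
    rw [K.planeWave_mk]
    exact Hom.ofSeq_eq.2 (hs.mono fun n hn => LinearMap.ext_ring ((K.wave_one s n).trans hn))
  · rw [← map_zero (ScaledZMod.mk C.ωir C.ω), K.zone_eq]
    refine (K.planeWave_mk fun _ => 0).trans (Hom.ofSeq_eq.2 (K.cyclic.mono fun n hn => ?_))
    refine LinearMap.ext_ring ((K.wave_one _ n).trans ?_)
    rw [Int.cast_zero, zero_div]
    exact hn.planeWave_zero
  · intro E E'
    obtain ⟨s, rfl⟩ := ScaledZMod.mk_surjective E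
    obtain ⟨s', rfl⟩ := ScaledZMod.mk_surjective E'
    induction s using Germ.inductionOn with | h s =>
    induction s' using Germ.inductionOn with | h s' =>
    rw [← map_add, K.planeWave_mk, K.planeWave_mk]
    refine (K.planeWave_mk fun n => s n + s' n).trans
      ((C.pair.Z.mulStates_ofSeq K.zmul_eq _ _ _).2 (K.cyclic.mono fun n hn => ?_))
    rw [K.wave_one, K.wave_one, K.wave_one]
    exact (hn.mul_planeWave _ _).symm

end QuantumClock

/-! ### Energies and characters -/

section EnergyPhases

variable {G : Type v} [AddCommGroup G] [TopologicalSpace G]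

/-- The one-dimensional quantum dynamical system given by a character. -/
noncomputable def QuantumDynamicalSystem.ofCharacter (χ : PontryaginDual (Multiplicative G)) :
    QuantumDynamicalSystem.{u, v} G where
  space := EuclideanSpace ℂ PUnit.{u + 1}
  U :=
    { toFun := fun t => ⟨(χ t : ℂ) • 1, by
        rw [Unitary.mem_iff]
        constructor <;>
        · rw [star_smul, star_one, smul_mul_smul_comm, mul_one]
          simp [← Circle.coe_inv_eq_conj]⟩
      map_one' := by ext1; simp
      map_mul' := fun s t => by
        ext1
        simp [mul_smul, smul_comm (χ s : ℂ)] }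
  continuous_U ψ := by
    change Continuous fun t : G => ((χ (Multiplicative.ofAdd t) : ℂ) •
      (1 : EuclideanSpace ℂ PUnit.{u + 1} →L[ℂ] EuclideanSpace ℂ PUnit.{u + 1})) ψ
    have h : Continuous fun t : G => (χ (Multiplicative.ofAdd t) : ℂ) :=
      continuous_subtype_val.comp ((map_continuous χ).comp continuous_ofAdd)
    exact h.smul continuous_const

theorem character_mem_energyPhases (χ : PontryaginDual (Multiplicative G)) :
    (fun t : G => (χ (Multiplicative.ofAdd t) : ℂ)) ∈ energyPhases.{u} G :=
  ⟨.ofCharacter χ, (WithLp.toLp 2 fun _ => 1 : EuclideanSpace ℂ PUnit.{u + 1}), fun h => by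
    exact one_ne_zero (congrArg (fun ψ : EuclideanSpace ℂ PUnit.{u + 1} => ψ PUnit.unit) h), fun _ => rfl⟩

/-- Continuity comes from `c t = ⟨ψ, U_t ψ⟩ / ⟨ψ, ψ⟩`, and modulus one from unitarity. -/
theorem exists_character_of_mem_energyPhases {c : G → ℂ} (hc : c ∈ energyPhases.{u} G) :
    ∃ χ : PontryaginDual (Multiplicative G),
      (fun t : G => (χ (Multiplicative.ofAdd t) : ℂ)) = c := by
  obtain ⟨S, ψ, hψ, h⟩ := hc
  have hn : ‖ψ‖ ≠ 0 := norm_ne_zero_iff.2 hψ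
  have hnorm : ∀ t, ‖c t‖ = 1 := fun t => by
    have := Unitary.norm_map (S.U (Multiplicative.ofAdd t)) ψ
    rw [h, norm_smul] at this
    exact mul_right_cancel₀ hn (this.trans (one_mul _).symm)
  have hadd : ∀ s t, c (s + t) = c s * c t := fun s t => by
    refine smul_left_injective ℂ hψ ?_
    change c (s + t) • ψ = (c s * c t) • ψ
    rw [← h, ofAdd_add, map_mul, mul_comm (c s), ← smul_smul, ← h s, ← map_smul, ← h t]
    rfl
  have hcont : Continuous c := by
    have h1 : c = fun t => inner ℂ ψ ((S.U (Multiplicative.ofAdd t) :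
        S.space →L[ℂ] S.space) ψ) / inner ℂ ψ ψ := by
      funext t
      rw [h, inner_smul_right, mul_div_cancel_right₀ _ (inner_self_ne_zero.2 hψ)]
    rw [h1]
    exact (continuous_const.inner (S.continuous_U ψ)).div_const _
  have h0 : c 0 = 1 := by
    have := h 0
    rw [ofAdd_zero, map_one] at this
    exact smul_left_injective ℂ hψ (this.symm.trans (one_smul ℂ ψ).symm)
  exact ⟨{
    toFun := fun t => ⟨c t.toAdd, mem_sphere_zero_iff_norm.2 (hnorm _)⟩
    map_one' := Subtype.ext h0
    map_mul' := fun s t => Subtype.ext (hadd _ _)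
    continuous_toFun := (hcont.comp continuous_toAdd).subtype_mk _ }, rfl⟩

theorem bijOn_energyPhases :
    Set.BijOn (fun (χ : PontryaginDual (Multiplicative G)) (t : G) =>
      (χ (Multiplicative.ofAdd t) : ℂ)) Set.univ (energyPhases.{u} G) :=
  ⟨fun χ _ => character_mem_energyPhases χ,
    fun χ _ χ' _ h => PontryaginDual.ext fun t => Circle.coe_injective (congrFun h t.toAdd),
    fun c hc => by
      obtain ⟨χ, hχ⟩ := exists_character_of_mem_energyPhases hc
      exact ⟨χ, Set.mem_univ _, hχ⟩⟩

end EnergyPhases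

/-! ### Characters of closed subgroups of the real line -/

/-- Lift `f` through the covering `Circle.exp` to `g` with `g 0 = 0`. As `x ↦ g (x + y) - g y` is
another such lift, uniqueness makes `g` additive, and a continuous additive function on `ℝ` is
linear. -/
theorem AddChar.exists_eq_fourierChar_real (f : AddChar ℝ Circle) (hf : Continuous f) :
    ∃ θ : ℝ, ∀ x, f x = Real.fourierChar (θ * x) := by
  obtain ⟨g, ⟨hg0, hg⟩, -⟩ := Circle.isCoveringMap_exp.existsUnique_continuousMap_lifts
    ⟨f, hf⟩ (0 : ℝ) (0 : ℝ) (by simp)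
  have hg : ∀ x, Circle.exp (g x) = f x := fun x => congrFun hg x
  have hadd : ∀ y x, g (x + y) - g y = g x := fun y x => by
    obtain ⟨k, -, hk⟩ := Circle.isCoveringMap_exp.existsUnique_continuousMap_lifts
      ⟨f, hf⟩ (0 : ℝ) (0 : ℝ) (by simp)
    have h1 := hk ⟨fun x => g (x + y) - g y, by fun_prop⟩ ⟨by simp, funext fun x => by
      simp [hg, Circle.exp_sub, AddChar.map_add_eq_mul]⟩
    have h2 := hk g ⟨hg0, funext hg⟩
    exact DFunLike.congr_fun (h1.trans h2.symm) x
  let L : ℝ →+ ℝ := ⟨⟨g, hg0⟩, fun x y => by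
    have := hadd y x
    change g (x + y) = g x + g y
    linarith⟩
  refine ⟨g 1 / (2 * Real.pi), fun x => ?_⟩
  have hx : g x = g 1 * x := by
    have := map_real_smul L g.continuous x 1
    simp only [smul_eq_mul, mul_one] at this
    rw [mul_comm]
    exact this
  rw [← hg, Real.fourierChar_apply', hx]
  congr 1
  field_simp

theorem Circle.exists_fourierChar_eq (z : Circle) : ∃ x, Real.fourierChar x = z := by
  refine ⟨Complex.arg z / (2 * Real.pi), ?_⟩
  rw [Real.fourierChar_apply', mul_div_cancel₀ _ Real.two_pi_pos.ne', Circle.exp_arg]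

theorem Real.fourierChar_eq_one_iff {x : ℝ} : Real.fourierChar x = 1 ↔ ∃ n : ℤ, x = n := by
  rw [Real.fourierChar_apply', ← Circle.exp_zero, Circle.exp_eq_exp]
  refine exists_congr fun n => ?_
  rw [zero_add, mul_comm (n : ℝ)]
  exact mul_right_inj' Real.two_pi_pos.ne'

/-- A closed subgroup of `ℝ` is everything or cyclic; in the cyclic case `θ` only has to match the
value at a generator. -/
theorem AddChar.exists_eq_fourierChar {S : AddSubgroup ℝ} (hS : IsClosed (S : Set ℝ))
    (f : AddChar S Circle) (hf : Continuous f) :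
    ∃ θ : ℝ, ∀ x : S, f x = Real.fourierChar (θ * x) := by
  obtain hd | ⟨g, hg⟩ := S.dense_or_cyclic
  · have hmem : ∀ x, x ∈ S := fun x => by
      have : (S : Set ℝ) = Set.univ := by rw [← hS.closure_eq, hd.closure_eq]
      exact (Set.ext_iff.1 this x).2 (Set.mem_univ x)
    obtain ⟨θ, hθ⟩ := AddChar.exists_eq_fourierChar_real
      ⟨fun x => f ⟨x, hmem x⟩, f.map_zero_eq_one, fun x y => f.map_add_eq_mul ⟨x, hmem x⟩ ⟨y, hmem y⟩⟩
      (hf.comp (continuous_id.subtype_mk hmem))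
    exact ⟨θ, fun x => hθ x⟩
  · rw [← AddSubgroup.zmultiples_eq_closure] at hg
    subst hg
    obtain ⟨y, hy⟩ := Circle.exists_fourierChar_eq (f ⟨g, AddSubgroup.mem_zmultiples g⟩)
    refine ⟨y / g, fun x => ?_⟩
    obtain ⟨_, n, rfl⟩ := x
    -- For the trivial subgroup `y / g` is zero by convention, and any `θ` would do.
    by_cases h0 : g = 0
    · subst h0
      simp only [smul_zero, mul_zero, AddChar.map_zero_eq_one]
      exact f.map_zero_eq_one
    · have h1 : f ⟨n • g, n, rfl⟩ = f ⟨g, AddSubgroup.mem_zmultiples g⟩ ^ n :=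
        f.map_zsmul_eq_zpow n ⟨g, _⟩
      refine h1.trans ?_
      rw [← hy, ← AddChar.map_zsmul_eq_zpow]
      congr 1
      simp only [zsmul_eq_mul]
      field_simp

/-! ### Finite hyperreals and non-standard integers -/

section Hyperreals

open Topology ArchimedeanClass

theorem Hyperreal.tendsto_stdPart {x : ℝ*} (hx : 0 ≤ ArchimedeanClass.mk x) :
    Germ.Tendsto x (𝓝 (stdPart x)) :=
  Hyperreal.tendsto_iff_forall.2
    ⟨fun _ hs => (lt_of_lt_stdPart Hyperreal.coeRingHom hx hs).le,
      fun _ hs => (lt_of_stdPart_lt Hyperreal.coeRingHom hx hs).le⟩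

theorem Hyperreal.abs_sub_lt {x : ℝ*} (hx : 0 ≤ ArchimedeanClass.mk x) {r ε : ℝ}
    (h : |stdPart x - r| < ε) : |x - (r : ℝ*)| < (ε : ℝ*) := by
  have ht := Hyperreal.tendsto_stdPart hx
  obtain ⟨f, rfl⟩ := Hyperreal.ofSeq_surjective x
  have ht' : Tendsto f (hyperfilter ℕ) (𝓝 (stdPart (Hyperreal.ofSeq f))) := ht
  exact Hyperreal.ofSeq_lt_ofSeq.2 (((ht'.sub_const r).abs).eventually_lt_const h)

theorem Hyperreal.finite_and_stdPart_eq {x : ℝ*} {r : ℝ}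
    (h : ∀ ε : ℝ, 0 < ε → |x - (r : ℝ*)| ≤ (ε : ℝ*)) :
    0 ≤ ArchimedeanClass.mk x ∧ stdPart x = r := by
  have ht : Germ.Tendsto x (𝓝 r) := by
    refine Hyperreal.tendsto_iff_forall.2 ⟨fun s hs => ?_, fun s hs => ?_⟩
    · have := (abs_le.1 (h (r - s) (sub_pos.2 hs))).1
      rw [Hyperreal.coe_sub] at this
      linarith
    · have := (abs_le.1 (h (s - r) (sub_pos.2 hs))).2
      rw [Hyperreal.coe_sub] at this
      linarith
  exact ⟨Hyperreal.archimedeanClassMk_nonneg_of_tendsto ht, Hyperreal.stdPart_of_tendsto ht⟩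

theorem Hyperreal.stdPart_abs {x : ℝ*} : stdPart |x| = |stdPart x| := by
  obtain h | h := le_total 0 x
  · rw [abs_of_nonneg h, abs_of_nonneg (stdPart_nonneg h)]
  · rw [abs_of_nonpos h, abs_of_nonpos (stdPart_nonpos h), stdPart_neg]

theorem Hyperreal.finite_of_abs_le {x : ℝ*} {r : ℝ} (h : |x| ≤ (r : ℝ*)) :
    0 ≤ ArchimedeanClass.mk x :=
  (Hyperreal.archimedeanClassMk_coe_nonneg r).trans
    (mk_le_mk_of_abs (h.trans (le_abs_self _)))

theorem Hyperreal.stdPart_abs_le {x y : ℝ*} (hx : 0 ≤ ArchimedeanClass.mk x)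
    (hy : 0 ≤ ArchimedeanClass.mk y) (h : |x| ≤ |y|) : |stdPart x| ≤ |stdPart y| := by
  rw [← stdPart_abs, ← stdPart_abs]
  refine stdPart_monotoneOn ?_ ?_ h
  · rwa [← mk_abs] at hx
  · rwa [← mk_abs] at hy

namespace HInt

theorem toReal_zero : (0 : HInt).toReal = 0 := congrArg (fun r : ℝ => (r : ℝ*)) Int.cast_zero

theorem toReal_add (m n : HInt) : (m + n).toReal = m.toReal + n.toReal := by
  induction m using Germ.inductionOn with | h m =>
  induction n using Germ.inductionOn with | h n =>
  exact congrArg Hyperreal.ofSeq (funext fun _ => Int.cast_add _ _)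

theorem toReal_mul (m n : HInt) : (m * n).toReal = m.toReal * n.toReal := by
  induction m using Germ.inductionOn with | h m =>
  induction n using Germ.inductionOn with | h n =>
  exact congrArg Hyperreal.ofSeq (funext fun _ => Int.cast_mul _ _)

theorem toReal_neg (m : HInt) : (-m).toReal = -m.toReal := by
  rw [eq_neg_iff_add_eq_zero, ← toReal_add, neg_add_cancel, toReal_zero]

theorem toReal_sub (m n : HInt) : (m - n).toReal = m.toReal - n.toReal := by
  rw [sub_eq_add_neg, toReal_add, toReal_neg, ← sub_eq_add_neg]

theorem toReal_toInt (ω : HNat) : ω.toInt.toReal = ω.toReal := by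
  induction ω using Germ.inductionOn with | h w =>
  exact congrArg Hyperreal.ofSeq (funext fun _ => Int.cast_natCast _)

/-- Componentwise rounding. The bound is used for division by an infinite number, and the minimality
for closedness of `stdLattice`. -/
theorem exists_round (x : ℝ*) : ∃ n : HInt, |n.toReal - x| ≤ ((1 / 2 : ℝ) : ℝ*) ∧
    ∀ m : HInt, |n.toReal - x| ≤ |m.toReal - x| := by
  obtain ⟨f, rfl⟩ := Hyperreal.ofSeq_surjective x
  refine ⟨((fun i => round (f i) : ℕ → ℤ) : HInt), ?_, fun m => ?_⟩
  · refine Hyperreal.ofSeq_le_ofSeq.2 (Eventually.of_forall fun i => ?_)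
    exact (abs_sub_comm _ _).trans_le (abs_sub_round (f i))
  · induction m using Germ.inductionOn with | h m =>
    refine Hyperreal.ofSeq_le_ofSeq.2 (Eventually.of_forall fun i => ?_)
    exact (abs_sub_comm _ _).trans_le ((round_le (f i) (m i)).trans_eq (abs_sub_comm _ _))

theorem exists_ceil (x : ℝ*) : ∃ n : HInt, x ≤ n.toReal ∧ n.toReal < x + 1 := by
  obtain ⟨f, rfl⟩ := Hyperreal.ofSeq_surjective x
  exact ⟨((fun i => ⌈f i⌉ : ℕ → ℤ) : HInt),
    Hyperreal.ofSeq_le_ofSeq.2 (Eventually.of_forall fun i => Int.le_ceil (f i)),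
    Hyperreal.ofSeq_lt_ofSeq.2 (Eventually.of_forall fun i => Int.ceil_lt_add_one (f i))⟩

/-- The standard part is a limit of integers along the ultrafilter, and `ℤ` is closed in `ℝ`. -/
theorem exists_stdPart_eq {n : HInt} (hn : 0 ≤ ArchimedeanClass.mk n.toReal) :
    ∃ k : ℤ, stdPart n.toReal = k := by
  have ht := Hyperreal.tendsto_stdPart hn
  induction n using Germ.inductionOn with | h n =>
  have ht' : Tendsto (fun i => (n i : ℝ)) (hyperfilter ℕ)
    (𝓝 (stdPart (HInt.toReal (n : HInt)))) := ht
  obtain ⟨k, hk⟩ := Int.isClosedEmbedding_coe_real.isClosed_range.mem_of_tendsto ht'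
    (Eventually.of_forall fun i => Set.mem_range_self (n i))
  exact ⟨k, hk.symm⟩

end HInt

namespace ScaledZMod

variable {a : ℝ*} {ω : HNat}

theorem exists_mk_eq (x : ScaledZMod a ω) : ∃ n : HInt, mk a ω n = x ∧ x.val = n.toReal / a := by
  obtain ⟨m, rfl⟩ := mk_surjective x
  refine ⟨balancedMod ω m, ?_, val_mk m⟩
  rw [mk_eq_mk]
  induction ω using Germ.inductionOn with | h w =>
  induction m using Germ.inductionOn with | h m =>
  have h : ∀ i, (w i : ℤ) ∣ (m i : ZMod (w i)).valMinAbs - m i := fun i => by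
    rw [← ZMod.intCast_eq_intCast_iff_dvd_sub, ZMod.coe_valMinAbs]
  choose j hj using h
  exact ⟨(j : HInt), congrArg (fun f : ℕ → ℤ => (f : HInt)) (funext hj)⟩

theorem exists_val_mk (m : HInt) :
    ∃ j : HInt, (mk a ω m).val = (m.toReal + ω.toReal * j.toReal) / a := by
  obtain ⟨n, hn, hv⟩ := exists_mk_eq (mk a ω m)
  obtain ⟨j, hj⟩ := mk_eq_mk.1 hn
  refine ⟨j, ?_⟩
  rw [hv, ← HInt.toReal_toInt, ← HInt.toReal_mul, ← HInt.toReal_add, ← hj, add_sub_cancel]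

/-- The balanced residue has the least absolute value in its class. -/
theorem abs_val_mk_le (m : HInt) : |(mk a ω m).val| ≤ |m.toReal / a| := by
  rw [val_mk, abs_div, abs_div]
  refine div_le_div_of_nonneg_right ?_ (abs_nonneg a)
  induction ω using Germ.inductionOn with | h w =>
  induction m using Germ.inductionOn with | h m =>
  refine Hyperreal.ofSeq_le_ofSeq.2 (Eventually.of_forall fun i => ?_)
  have h : ((m i : ZMod (w i)).valMinAbs).natAbs ≤ (m i).natAbs := by
    by_cases hw : w i = 0
    · have h0 : ((m i : ZMod (w i)).valMinAbs) = m i := by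
        generalize w i = k at hw
        subst hw
        rfl
      rw [h0]
    · have : NeZero (w i) := ⟨hw⟩
      exact ZMod.natAbs_min_of_le_div_two (w i) _ _ (ZMod.coe_valMinAbs _)
        (ZMod.natAbs_valMinAbs_le _)
  have h' : |(m i : ZMod (w i)).valMinAbs| ≤ |m i| := by
    rw [Int.abs_eq_natAbs, Int.abs_eq_natAbs]
    exact_mod_cast h
  change |(((m i : ZMod (w i)).valMinAbs : ℤ) : ℝ)| ≤ |((m i : ℤ) : ℝ)|
  exact_mod_cast h'

theorem abs_val_le (ha : 0 < a) (hω : 0 < ω.toReal) (x : ScaledZMod a ω) :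
    |x.val| ≤ ω.toReal / a / ((2 : ℝ) : ℝ*) := by
  obtain ⟨m, rfl⟩ := mk_surjective x
  rw [val_mk, abs_div, abs_of_pos ha, div_right_comm]
  refine div_le_div_of_nonneg_right ?_ ha.le
  induction ω using Germ.inductionOn with | h w =>
  induction m using Germ.inductionOn with | h m =>
  refine Hyperreal.ofSeq_le_ofSeq.2
    ((Hyperreal.ofSeq_lt_ofSeq.1 hω : ∀ᶠ i in _, (0 : ℝ) < w i).mono fun i hi => ?_)
  have : NeZero (w i) := ⟨(Nat.cast_pos.1 hi).ne'⟩
  have h := ZMod.natAbs_valMinAbs_le (m i : ZMod (w i))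
  have h2 : |((m i : ZMod (w i)).valMinAbs)| * 2 ≤ w i := by
    rw [Int.abs_eq_natAbs]
    omega
  change |(((m i : ZMod (w i)).valMinAbs : ℤ) : ℝ)| ≤ (w i : ℝ) / 2
  rw [le_div_iff₀ two_pos]
  exact_mod_cast h2

/-- Up to a non-standard integer, the product of elements of `(1/b) ℤ_ω` and `(1/a) ℤ_ω` does not
depend on the representatives. -/
theorem exists_val_mul_val {b : ℝ*} (ha : a ≠ 0) (hb : b ≠ 0) (hab : a * b = ω.toReal)
    (s n : HInt) : ∃ i : HInt,
      (mk b ω s).val * (mk a ω n).val - s.toReal / b * (n.toReal / a) = i.toReal := by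
  obtain ⟨j, hj⟩ := exists_val_mk (a := b) (ω := ω) s
  obtain ⟨k, hk⟩ := exists_val_mk (a := a) (ω := ω) n
  -- Expand `(s + ω j) (n + ω k) / (a b)` with `a b = ω`: every term but `s n / (a b)` loses one
  -- factor `ω`.
  refine ⟨s * k + j * n + ω.toInt * (j * k), ?_⟩
  rw [hj, hk]
  simp only [HInt.toReal_add, HInt.toReal_mul, HInt.toReal_toInt, ← hab]
  field_simp
  ring

end ScaledZMod

end Hyperreals

/-! ### The topology of the standard part -/

section Duality

open Topology ArchimedeanClass

section Topology

variable {a : ℝ*} {ω : HNat}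

theorem finElements_norm_eq (t : finElements a ω) : ‖t‖ = |stdPart t.1.val| :=
  Hyperreal.stdPart_abs

/-- The class of `n / a`, for `n / a` finite. -/
noncomputable def finMk (a : ℝ*) (ω : HNat) (n : HInt)
    (hn : 0 ≤ ArchimedeanClass.mk (n.toReal / a)) : finElements a ω :=
  ⟨ScaledZMod.mk a ω n, hn.trans (mk_le_mk_of_abs (ScaledZMod.abs_val_mk_le n))⟩

theorem exists_finMk_eq (t : finElements a ω) :
    ∃ n hn, finMk a ω n hn = t ∧ t.1.val = n.toReal / a := by
  obtain ⟨n, hn, hv⟩ := ScaledZMod.exists_mk_eq t.1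
  exact ⟨n, hv ▸ t.2, Subtype.ext hn, hv⟩

theorem Hyperreal.finite_sub {x y : ℝ*} (hx : 0 ≤ ArchimedeanClass.mk x) (hy : 0 ≤ ArchimedeanClass.mk y) :
    0 ≤ ArchimedeanClass.mk (x - y) :=
  (le_min hx hy).trans (min_le_mk_sub x y)

theorem Hyperreal.finite_add {x y : ℝ*} (hx : 0 ≤ ArchimedeanClass.mk x) (hy : 0 ≤ ArchimedeanClass.mk y) :
    0 ≤ ArchimedeanClass.mk (x + y) :=
  (le_min hx hy).trans (min_le_mk_add x y)

theorem Hyperreal.finite_mul {x y : ℝ*} (hx : 0 ≤ ArchimedeanClass.mk x) (hy : 0 ≤ ArchimedeanClass.mk y) :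
    0 ≤ ArchimedeanClass.mk (x * y) := by
  rw [ArchimedeanClass.mk_mul]
  exact add_nonneg hx hy

theorem finite_add_div {n m : HInt} (hn : 0 ≤ ArchimedeanClass.mk (n.toReal / a))
    (hm : 0 ≤ ArchimedeanClass.mk (m.toReal / a)) :
    0 ≤ ArchimedeanClass.mk ((n + m).toReal / a) := by
  rw [HInt.toReal_add, add_div]
  exact Hyperreal.finite_add hn hm

theorem finite_sub_div {n m : HInt} (hn : 0 ≤ ArchimedeanClass.mk (n.toReal / a))
    (hm : 0 ≤ ArchimedeanClass.mk (m.toReal / a)) :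
    0 ≤ ArchimedeanClass.mk ((n - m).toReal / a) := by
  rw [HInt.toReal_sub, sub_div]
  exact Hyperreal.finite_sub hn hm

theorem stdPart_add_div {n m : HInt} (hn : 0 ≤ ArchimedeanClass.mk (n.toReal / a))
    (hm : 0 ≤ ArchimedeanClass.mk (m.toReal / a)) :
    stdPart ((n + m).toReal / a) = stdPart (n.toReal / a) + stdPart (m.toReal / a) := by
  rw [HInt.toReal_add, add_div, stdPart_add hn hm]

theorem stdPart_sub_div {n m : HInt} (hn : 0 ≤ ArchimedeanClass.mk (n.toReal / a))
    (hm : 0 ≤ ArchimedeanClass.mk (m.toReal / a)) :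
    stdPart ((n - m).toReal / a) = stdPart (n.toReal / a) - stdPart (m.toReal / a) := by
  rw [HInt.toReal_sub, sub_div, stdPart_sub hn hm]

theorem finMk_add {n m : HInt} (hn : 0 ≤ ArchimedeanClass.mk (n.toReal / a))
    (hm : 0 ≤ ArchimedeanClass.mk (m.toReal / a)) :
    finMk a ω (n + m) (finite_add_div hn hm) = finMk a ω n hn + finMk a ω m hm :=
  Subtype.ext (map_add _ _ _)

theorem finMk_sub {n m : HInt} (hn : 0 ≤ ArchimedeanClass.mk (n.toReal / a))
    (hm : 0 ≤ ArchimedeanClass.mk (m.toReal / a)) :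
    finMk a ω (n - m) (finite_sub_div hn hm) = finMk a ω n hn - finMk a ω m hm :=
  Subtype.ext (map_sub _ _ _)

theorem dist_finMk_le {n m : HInt} (hn : 0 ≤ ArchimedeanClass.mk (n.toReal / a))
    (hm : 0 ≤ ArchimedeanClass.mk (m.toReal / a)) :
    dist (finMk a ω n hn) (finMk a ω m hm) ≤
      |stdPart (n.toReal / a) - stdPart (m.toReal / a)| := by
  rw [dist_eq_norm, ← finMk_sub, finElements_norm_eq, ← stdPart_sub_div hn hm]
  exact Hyperreal.stdPart_abs_le (finMk a ω _ (finite_sub_div hn hm)).2 (finite_sub_div hn hm)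
    (ScaledZMod.abs_val_mk_le _)

theorem stdClass_eq_zero_iff {t : finElements a ω} :
    stdClass t = 0 ↔ 0 < ArchimedeanClass.mk t.1.val :=
  QuotientAddGroup.eq_zero_iff t

theorem stdClass_eq_zero_iff_norm {t : finElements a ω} : stdClass t = 0 ↔ ‖t‖ = 0 := by
  rw [stdClass_eq_zero_iff, finElements_norm_eq, abs_eq_zero, stdPart_eq_zero]
  exact ⟨fun h => h.ne', fun h => lt_of_le_of_ne t.2 h.symm⟩

theorem stdClass_surjective : Function.Surjective (stdClass : finElements a ω → StdGroup a ω) :=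
  QuotientAddGroup.mk_surjective

theorem stdClass_finMk_eq {n m : HInt} (hn : 0 ≤ ArchimedeanClass.mk (n.toReal / a))
    (hm : 0 ≤ ArchimedeanClass.mk (m.toReal / a))
    (h : stdPart (n.toReal / a) = stdPart (m.toReal / a)) :
    stdClass (finMk a ω n hn) = stdClass (finMk a ω m hm) := by
  have h1 : dist (finMk a ω n hn) (finMk a ω m hm) = 0 :=
    le_antisymm ((dist_finMk_le hn hm).trans (by rw [h, sub_self, abs_zero])) dist_nonneg
  rw [dist_eq_norm, ← stdClass_eq_zero_iff_norm] at h1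
  exact sub_eq_zero.1 h1

/-- The standard parts of the finite `n / a`, with `n` a non-standard integer. -/
def stdLattice (a : ℝ*) : AddSubgroup ℝ where
  carrier := {r | ∃ n : HInt, 0 ≤ ArchimedeanClass.mk (n.toReal / a) ∧ stdPart (n.toReal / a) = r}
  zero_mem' := ⟨0, by simp [HInt.toReal_zero], by simp [HInt.toReal_zero]⟩
  add_mem' := by
    rintro _ _ ⟨n, hn, rfl⟩ ⟨m, hm, rfl⟩
    exact ⟨n + m, finite_add_div hn hm, stdPart_add_div hn hm⟩
  neg_mem' := by
    rintro _ ⟨n, hn, rfl⟩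
    refine ⟨-n, ?_, ?_⟩
    · rwa [HInt.toReal_neg, neg_div, ArchimedeanClass.mk_neg]
    · rw [HInt.toReal_neg, neg_div, stdPart_neg]

/-- With `n` the integer nearest to `r a`, no `m / a` is closer to `r` than `n / a`. If lattice
points approach `r`, then `n / a` is within every standard `ε` of it. -/
theorem isClosed_stdLattice (ha : 0 < a) : IsClosed (stdLattice a : Set ℝ) := by
  refine isClosed_of_closure_subset fun r hr => ?_
  obtain ⟨n, -, hn⟩ := HInt.exists_round (r * a)
  refine ⟨n, Hyperreal.finite_and_stdPart_eq fun ε hε => ?_⟩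
  obtain ⟨_, ⟨m, hm, rfl⟩, hmr⟩ := Metric.mem_closure_iff.1 hr ε hε
  rw [dist_comm, Real.dist_eq] at hmr
  refine le_trans ?_ (Hyperreal.abs_sub_lt hm hmr).le
  have h : ∀ k : HInt, |k.toReal / a - r| = |k.toReal - r * a| / a := fun k => by
    rw [← abs_of_pos ha, ← abs_div, abs_of_pos ha, sub_div, mul_div_cancel_right₀ _ ha.ne']
  rw [h, h]
  exact div_le_div_of_nonneg_right (hn m) ha.le

/-- A finite element with a given standard part. -/
noncomputable def stdSection (a : ℝ*) (ω : HNat) (r : stdLattice a) : finElements a ω :=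
  finMk a ω r.2.choose r.2.choose_spec.1

theorem dist_stdSection_le {n : HInt} (hn : 0 ≤ ArchimedeanClass.mk (n.toReal / a))
    (r : stdLattice a) : dist (finMk a ω n hn) (stdSection a ω r) ≤ |stdPart (n.toReal / a) - r| :=
  (dist_finMk_le hn r.2.choose_spec.1).trans_eq (by rw [r.2.choose_spec.2])

theorem stdClass_stdSection {n : HInt} (hn : 0 ≤ ArchimedeanClass.mk (n.toReal / a))
    (r : stdLattice a) (h : stdPart (n.toReal / a) = r) :
    stdClass (stdSection a ω r) = stdClass (finMk a ω n hn) :=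
  stdClass_finMk_eq _ _ (r.2.choose_spec.2.trans h.symm)

theorem lipschitzWith_stdSection : LipschitzWith 1 (stdSection a ω) :=
  LipschitzWith.mk_one fun r s => (dist_stdSection_le _ s).trans_eq (by
    rw [r.2.choose_spec.2]; rfl)

/-- A closed ball lies in the closure of the image, under the continuous `stdSection`, of the
compact set of lattice points in `[-R, R]`; the closure accounts for infinitesimals. -/
theorem properSpace_finElements (ha : 0 < a) : ProperSpace (finElements a ω) := by
  refine ProperSpace.of_seq_closedBall (l := atTop) (x := 0) (r := fun R : ℝ => R) tendsto_id
    (Eventually.of_forall fun R => ?_)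
  have hK : IsCompact (stdSection a ω '' (Subtype.val ⁻¹' Set.Icc (-R) R)) :=
    ((isClosed_stdLattice ha).isClosedEmbedding_subtypeVal.isCompact_preimage
      isCompact_Icc).image lipschitzWith_stdSection.continuous
  refine hK.closure.of_isClosed_subset Metric.isClosed_closedBall fun t ht => ?_
  rw [mem_closedBall_zero_iff, finElements_norm_eq] at ht
  obtain ⟨n, hn, rfl, hv⟩ := exists_finMk_eq t
  rw [hv, abs_le] at ht
  refine Metric.mem_closure_iff.2 fun ε hε => ⟨_, ⟨⟨_, n, hn, rfl⟩, ht, rfl⟩, ?_⟩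
  exact (dist_stdSection_le hn _).trans_lt (by simpa using hε)

end Topology

/-! ### The pairing between times and energies -/

section Pairing

variable {a b : ℝ*} {ω : HNat}

/-- The phase `st (exp (- 2 π i E t))`. -/
noncomputable def finPairing (E : finElements b ω) (t : finElements a ω) : Circle :=
  Real.fourierChar (-(stdPart E.1.val * stdPart t.1.val))

theorem Real.fourierChar_eq_of_sub_eq_int {x y : ℝ} {k : ℤ} (h : x - y = k) :
    Real.fourierChar x = Real.fourierChar y := by
  have h1 : x = y + k := by linarith
  rw [h1, AddChar.map_add_eq_mul, Real.fourierChar_eq_one_iff.2 ⟨k, rfl⟩, mul_one]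

theorem coe_finPairing (E : finElements b ω) (t : finElements a ω) :
    (finPairing E t : ℂ) = complexStdPart (hyperPhase (-(E.1.val * t.1.val))) := by
  have hf : 0 ≤ ArchimedeanClass.mk (-(E.1.val * t.1.val)) := by
    rw [ArchimedeanClass.mk_neg]
    exact Hyperreal.finite_mul E.2 t.2
  have hst : stdPart (-(E.1.val * t.1.val)) = -(stdPart E.1.val * stdPart t.1.val) := by
    rw [stdPart_neg, stdPart_mul E.2 t.2]
  have key := Hyperreal.tendsto_stdPart hf
  rw [hst] at key
  let f : ℝ → ℂ := fun r => Complex.exp (2 * Real.pi * Complex.I * r)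
  have hfc : Continuous f := by fun_prop
  have hval : ∀ r, (Real.fourierChar r : ℂ) = f r := fun r => by
    rw [Real.fourierChar_apply]
    congr 1
    push_cast
    ring
  rw [finPairing, hval]
  refine Complex.ext (Eq.symm ?_) (Eq.symm ?_)
  · have h := Hyperreal.stdPart_of_tendsto (Hyperreal.stdPart_map
      (Complex.continuous_re.comp hfc).continuousAt key)
    refine Eq.trans (congrArg stdPart ?_) h
    generalize -(E.1.val * t.1.val) = x
    induction x using Germ.inductionOn
    rfl
  · have h := Hyperreal.stdPart_of_tendsto (Hyperreal.stdPart_map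
      (Complex.continuous_im.comp hfc).continuousAt key)
    refine Eq.trans (congrArg stdPart ?_) h
    generalize -(E.1.val * t.1.val) = x
    induction x using Germ.inductionOn
    rfl

variable (ha : a ≠ 0) (hb : b ≠ 0) (hab : a * b = ω.toReal)
include ha hb hab

/-- Reduction changes the product by a finite non-standard integer, whose standard part is an
integer. Unreduced representatives are additive, unlike balanced ones, and this yields bilinearity.
-/
theorem finPairing_finMk {s n : HInt} (hs : 0 ≤ ArchimedeanClass.mk (s.toReal / b))
    (hn : 0 ≤ ArchimedeanClass.mk (n.toReal / a)) :
    finPairing (finMk b ω s hs) (finMk a ω n hn) =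
      Real.fourierChar (-(stdPart (s.toReal / b) * stdPart (n.toReal / a))) := by
  obtain ⟨i, hi⟩ := ScaledZMod.exists_val_mul_val ha hb hab s n
  have hE : 0 ≤ ArchimedeanClass.mk (ScaledZMod.mk b ω s).val := (finMk b ω s hs).2
  have ht : 0 ≤ ArchimedeanClass.mk (ScaledZMod.mk a ω n).val := (finMk a ω n hn).2
  have h1 := Hyperreal.finite_mul hE ht
  have h2 := Hyperreal.finite_mul hs hn
  obtain ⟨k, hk⟩ := HInt.exists_stdPart_eq (n := i) (hi ▸ Hyperreal.finite_sub h1 h2)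
  rw [← hi, stdPart_sub h1 h2, stdPart_mul hs hn,
    stdPart_mul hE ht] at hk
  refine Real.fourierChar_eq_of_sub_eq_int (k := -k) ?_
  rw [Int.cast_neg, ← hk]
  change -(stdPart (ScaledZMod.mk b ω s).val * stdPart (ScaledZMod.mk a ω n).val) - _ = _
  ring

theorem finPairing_add_left (E E' : finElements b ω) (t : finElements a ω) :
    finPairing (E + E') t = finPairing E t * finPairing E' t := by
  obtain ⟨s, hs, rfl, -⟩ := exists_finMk_eq E
  obtain ⟨s', hs', rfl, -⟩ := exists_finMk_eq E'
  obtain ⟨n, hn, rfl, -⟩ := exists_finMk_eq t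
  rw [← finMk_add, finPairing_finMk ha hb hab, finPairing_finMk ha hb hab,
    finPairing_finMk ha hb hab, stdPart_add_div hs hs', ← AddChar.map_add_eq_mul]
  congr 1
  ring

theorem finPairing_add_right (E : finElements b ω) (t t' : finElements a ω) :
    finPairing E (t + t') = finPairing E t * finPairing E t' := by
  obtain ⟨s, hs, rfl, -⟩ := exists_finMk_eq E
  obtain ⟨n, hn, rfl, -⟩ := exists_finMk_eq t
  obtain ⟨n', hn', rfl, -⟩ := exists_finMk_eq t'
  rw [← finMk_add, finPairing_finMk ha hb hab, finPairing_finMk ha hb hab,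
    finPairing_finMk ha hb hab, stdPart_add_div hn hn', ← AddChar.map_add_eq_mul]
  congr 1
  ring

omit ha hb hab in
theorem finPairing_of_infinitesimal_left {E : finElements b ω} (hE : stdClass E = 0)
    (t : finElements a ω) : finPairing E t = 1 := by
  rw [stdClass_eq_zero_iff] at hE
  rw [finPairing, stdPart_eq_zero.2 hE.ne', zero_mul, neg_zero, AddChar.map_zero_eq_one]

omit ha hb hab in
theorem finPairing_of_infinitesimal_right (E : finElements b ω) {t : finElements a ω}
    (ht : stdClass t = 0) : finPairing E t = 1 := by
  rw [stdClass_eq_zero_iff] at ht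
  rw [finPairing, stdPart_eq_zero.2 ht.ne', mul_zero, neg_zero, AddChar.map_zero_eq_one]

end Pairing

variable {a b : ℝ*} {ω : HNat}

/-! ### Pontryagin duality of the standard parts -/

/-- The pairing of a finite element with the standard part of the dual group. -/
noncomputable def finCharacter (ha : a ≠ 0) (hb : b ≠ 0) (hab : a * b = ω.toReal)
    (E : finElements b ω) : StdGroup a ω →+ Additive Circle :=
  QuotientAddGroup.lift (infinitesimals a ω)
    (AddMonoidHom.mk' (fun t => Additive.ofMul (finPairing E t))
      fun t t' => congrArg Additive.ofMul (finPairing_add_right ha hb hab E t t'))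
    fun t ht => congrArg Additive.ofMul
      (finPairing_of_infinitesimal_right E ((QuotientAddGroup.eq_zero_iff t).2 ht))

/-- The pairing between the standard parts of `(1/b) ℤ_ω` and `(1/a) ℤ_ω`, for `ω = a b`. -/
noncomputable def stdPairing (ha : a ≠ 0) (hb : b ≠ 0) (hab : a * b = ω.toReal) :
    StdGroup b ω →+ StdGroup a ω →+ Additive Circle :=
  QuotientAddGroup.lift (infinitesimals b ω)
    (AddMonoidHom.mk' (finCharacter ha hb hab) fun E E' => AddMonoidHom.ext fun t => by
      obtain ⟨t, rfl⟩ := stdClass_surjective t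
      exact congrArg Additive.ofMul (finPairing_add_left ha hb hab E E' t))
    fun E hE => AddMonoidHom.ext fun t => by
      obtain ⟨t, rfl⟩ := stdClass_surjective t
      exact congrArg Additive.ofMul
        (finPairing_of_infinitesimal_left ((QuotientAddGroup.eq_zero_iff E).2 hE) t)

/-- Balanced values can jump at the wrap-around, so the formula does not show continuity directly.
Bilinear expansion around `(E₀, t₀)` leaves a constant and three factors whose phases are bounded by
products of norms tending to zero. -/
theorem continuous_finPairing (ha : a ≠ 0) (hb : b ≠ 0) (hab : a * b = ω.toReal) :
    Continuous fun p : finElements b ω × finElements a ω => finPairing p.1 p.2 := by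
  have key : ∀ {X : Type} (l : Filter X) (g : X → finElements b ω)
      (h : X → finElements a ω), Tendsto (fun x => ‖g x‖ * ‖h x‖) l (𝓝 0) →
      Tendsto (fun x => finPairing (g x) (h x)) l (𝓝 1) := by
    intro X l g h hgh
    have h1 : Tendsto (fun x => -(stdPart (g x).1.val * stdPart (h x).1.val)) l (𝓝 0) := by
      refine squeeze_zero_norm (fun x => ?_) hgh
      rw [norm_neg, norm_mul, finElements_norm_eq, finElements_norm_eq]
      rfl
    have h2 := (Real.continuous_fourierChar.tendsto 0).comp h1
    rwa [AddChar.map_zero_eq_one] at h2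
  have key' : ∀ (E₀ : finElements b ω) (t₀ : finElements a ω),
      (fun p : finElements b ω × finElements a ω => finPairing p.1 p.2) = fun p =>
        finPairing E₀ t₀ * finPairing E₀ (p.2 - t₀) *
          (finPairing (p.1 - E₀) t₀ * finPairing (p.1 - E₀) (p.2 - t₀)) := by
    intro E₀ t₀
    funext p
    rw [← finPairing_add_right ha hb hab, ← finPairing_add_right ha hb hab,
      ← finPairing_add_left ha hb hab, add_sub_cancel, add_sub_cancel]
  refine continuous_iff_continuousAt.2 fun ⟨E₀, t₀⟩ => ?_
  have c1 : Continuous fun p : finElements b ω × finElements a ω => ‖E₀‖ * ‖p.2 - t₀‖ := by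
    fun_prop
  have c2 : Continuous fun p : finElements b ω × finElements a ω => ‖p.1 - E₀‖ * ‖t₀‖ := by
    fun_prop
  have c3 : Continuous fun p : finElements b ω × finElements a ω => ‖p.1 - E₀‖ * ‖p.2 - t₀‖ := by
    fun_prop
  have h1 := key (𝓝 (E₀, t₀)) (fun _ => E₀) (fun p => p.2 - t₀)
    (by simpa using c1.tendsto (E₀, t₀))
  have h2 := key (𝓝 (E₀, t₀)) (fun p => p.1 - E₀) (fun _ => t₀)
    (by simpa using c2.tendsto (E₀, t₀))
  have h3 := key (𝓝 (E₀, t₀)) (fun p => p.1 - E₀) (fun p => p.2 - t₀)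
    (by simpa using c3.tendsto (E₀, t₀))
  rw [ContinuousAt, key' E₀ t₀]
  simpa using (h1.const_mul (finPairing E₀ t₀)).mul (h2.mul h3)

theorem continuous_stdPairing (ha : a ≠ 0) (hb : b ≠ 0) (hab : a * b = ω.toReal) :
    Continuous fun p : StdGroup b ω × StdGroup a ω => stdPairing ha hb hab p.1 p.2 := by
  have hq : IsOpenQuotientMap (Prod.map (stdClass : finElements b ω → StdGroup b ω)
      (stdClass : finElements a ω → StdGroup a ω)) :=
    QuotientAddGroup.isOpenQuotientMap_mk.prodMap QuotientAddGroup.isOpenQuotientMap_mk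
  refine hq.isQuotientMap.continuous_iff.2 ?_
  exact continuous_finPairing ha hb hab

/-- The character of the standard part of `(1/a) ℤ_ω` given by an element of the standard part
of `(1/b) ℤ_ω`. -/
noncomputable def dualityHom (ha : a ≠ 0) (hb : b ≠ 0) (hab : a * b = ω.toReal) :
    Multiplicative (StdGroup b ω) →* PontryaginDual (Multiplicative (StdGroup a ω)) where
  toFun e :=
    { toMonoidHom := AddMonoidHom.toMultiplicativeLeft (stdPairing ha hb hab e.toAdd)
      continuous_toFun := (continuous_stdPairing ha hb hab).comp
        (continuous_const.prodMk continuous_toAdd) }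
  map_one' := PontryaginDual.ext fun t => DFunLike.congr_fun (map_zero (stdPairing ha hb hab)) t.toAdd
  map_mul' e e' := PontryaginDual.ext fun t =>
    DFunLike.congr_fun (map_add (stdPairing ha hb hab) e.toAdd e'.toAdd) t.toAdd

theorem dualityHom_stdClass (ha : a ≠ 0) (hb : b ≠ 0) (hab : a * b = ω.toReal)
    (E : finElements b ω) (t : finElements a ω) :
    dualityHom ha hb hab (Multiplicative.ofAdd (stdClass E)) (Multiplicative.ofAdd (stdClass t)) =
      finPairing E t := rfl

theorem continuous_dualityHom (ha : a ≠ 0) (hb : b ≠ 0) (hab : a * b = ω.toReal) :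
    Continuous (dualityHom ha hb hab) :=
  ContinuousMonoidHom.continuous_of_continuous_uncurry _
    ((continuous_stdPairing ha hb hab).comp
      ((continuous_toAdd.comp continuous_fst).prodMk (continuous_toAdd.comp continuous_snd)))

theorem Hyperreal.finite_inv {x : ℝ*} (hx : ¬ 0 < ArchimedeanClass.mk x) :
    0 ≤ ArchimedeanClass.mk x⁻¹ := by
  rw [ArchimedeanClass.mk_inv]
  obtain h | h := (not_lt.1 hx).eq_or_lt
  · simp [h]
  · exact (LinearOrderedAddCommGroupWithTop.neg_pos.2 (Or.inl h)).le

/-- For a non-infinitesimal energy of balanced value `x`, a finite time `n / a` just above `1 / (4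
|x|)` has `|x| n / a` between `1/4` and `3/4`, so the phase is not `1`. -/
theorem dualityHom_injective (ha : 0 < a) (hb : 0 < b) (hab : a * b = ω.toReal) :
    Function.Injective (dualityHom ha.ne' hb.ne' hab) := by
  rw [injective_iff_map_eq_one]
  intro e he
  obtain ⟨E, hE⟩ := stdClass_surjective e.toAdd
  obtain rfl : e = Multiplicative.ofAdd (stdClass E) := by rw [hE]; rfl
  change stdClass E = 0
  by_contra hne
  rw [stdClass_eq_zero_iff] at hne
  obtain ⟨s, hs, rfl, hv⟩ := exists_finMk_eq E
  set x := s.toReal / b with hx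
  rw [hv] at hne
  have hx0 : 0 < |x| := abs_pos.2 fun h => hne (by simp [h])
  -- Balancedness gives `|x| ≤ ω / (2 b) = a / 2`, so rounding the time up by less than `1 / a` adds
  -- at most `1/2` to the product.
  have hxa : |x| ≤ a / 2 := by
    have h := ScaledZMod.abs_val_le hb (hab ▸ mul_pos ha hb) (finMk b ω s hs).1
    rwa [hv, ← hab, mul_div_cancel_right₀ _ hb.ne', Hyperreal.coe_ofNat] at h
  obtain ⟨n, hn1, hn2⟩ := HInt.exists_ceil (a / (4 * |x|))
  have hy1 : 1 / 4 ≤ |x| * (n.toReal / a) := by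
    rw [div_le_iff₀ (by positivity)] at hn1
    rw [mul_div_assoc', le_div_iff₀ ha]
    linarith
  have hy2 : |x| * (n.toReal / a) ≤ 3 / 4 := by
    rw [← sub_lt_iff_lt_add, lt_div_iff₀ (by positivity)] at hn2
    rw [mul_div_assoc', div_le_iff₀ ha]
    linarith
  have hyf : 0 ≤ ArchimedeanClass.mk (|x| * (n.toReal / a)) := by
    refine Hyperreal.finite_of_abs_le (r := 1) ?_
    rw [abs_of_nonneg (by linarith), Hyperreal.coe_one]
    linarith
  have hxi : 0 ≤ ArchimedeanClass.mk |x|⁻¹ := Hyperreal.finite_inv (by rwa [mk_abs])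
  have hn : 0 ≤ ArchimedeanClass.mk (n.toReal / a) := by
    have := Hyperreal.finite_mul hxi hyf
    rwa [inv_mul_cancel_left₀ hx0.ne'] at this
  have h1 := DFunLike.congr_fun he (Multiplicative.ofAdd (stdClass (finMk a ω n hn)))
  rw [dualityHom_stdClass, finPairing_finMk ha.ne' hb.ne' hab] at h1
  obtain ⟨k, hk⟩ := Real.fourierChar_eq_one_iff.1 h1
  have hst : stdPart (|x| * (n.toReal / a)) = |stdPart x| * stdPart (n.toReal / a) := by
    rw [stdPart_mul (by rwa [mk_abs]) hn, Hyperreal.stdPart_abs]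
  have hb1 : (1 / 4 : ℝ) ≤ stdPart (|x| * (n.toReal / a)) :=
    le_stdPart_of_le Hyperreal.coeRingHom hyf (by simpa using hy1)
  have hb2 : stdPart (|x| * (n.toReal / a)) ≤ (3 / 4 : ℝ) :=
    stdPart_le_of_le Hyperreal.coeRingHom hyf (by simpa using hy2)
  rw [hst] at hb1 hb2
  have habs : |(k : ℝ)| = |stdPart x| * stdPart (n.toReal / a) := by
    rw [← hk, abs_neg, abs_mul]
    congr 1
    refine abs_of_nonneg (not_lt.1 fun h => ?_)
    have := mul_nonpos_of_nonneg_of_nonpos (abs_nonneg (stdPart x)) h.le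
    linarith
  rw [← habs] at hb1 hb2
  have hk1 : (0 : ℝ) < |(k : ℝ)| := by linarith
  have hk2 : |(k : ℝ)| < 1 := by linarith
  rw [← Int.cast_abs] at hk1 hk2
  have hk1' : 0 < |k| := by exact_mod_cast hk1
  have hk2' : |k| < 1 := by exact_mod_cast hk2
  omega

/-- A real number `θ` is the standard part of an element of `(1/b) ℤ` as soon as `θ (st b)` is an
integer if `b` is finite. -/
theorem exists_stdPart_div_eq (hb : 0 < b) (hb' : ¬ 0 < ArchimedeanClass.mk b) (θ : ℝ)
    (h : 0 ≤ ArchimedeanClass.mk b → ∃ k : ℤ, θ * stdPart b = k) :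
    ∃ s : HInt, 0 ≤ ArchimedeanClass.mk (s.toReal / b) ∧ stdPart (s.toReal / b) = θ := by
  -- For finite `b` the standard integer `θ (st b)` serves as `s`; for infinite `b` rounding `θ b`
  -- leaves an error of at most `1 / (2 b)`, an infinitesimal.
  by_cases hf : 0 ≤ ArchimedeanClass.mk b
  · obtain ⟨k, hk⟩ := h hf
    have hb0 : ArchimedeanClass.mk b = 0 := le_antisymm (not_lt.1 hb') hf
    refine ⟨((fun _ => k : ℕ → ℤ) : HInt), ?_, ?_⟩
    · rw [div_eq_mul_inv]
      exact Hyperreal.finite_mul (Hyperreal.archimedeanClassMk_coe_nonneg (k : ℝ)) (Hyperreal.finite_inv hb')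
    · have h1 : stdPart (((k : ℝ) : ℝ*) / b) = k / stdPart b := by
        rw [stdPart_div (Hyperreal.archimedeanClassMk_coe_nonneg (k : ℝ)) (by simp [hb0]),
          Hyperreal.stdPart_coe]
      refine Eq.trans h1 ?_
      rw [← hk, mul_div_cancel_right₀]
      rw [ne_eq, stdPart_eq_zero]
      simp [hb0]
  · obtain ⟨s, hs, -⟩ := HInt.exists_round (θ * b)
    refine ⟨s, Hyperreal.finite_and_stdPart_eq fun ε hε => ?_⟩
    have h1 : |s.toReal / b - θ| = |s.toReal - θ * b| / b := by
      rw [← abs_of_pos hb, ← abs_div, abs_of_pos hb, sub_div, mul_div_cancel_right₀ _ hb.ne']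
    rw [h1, div_le_iff₀ hb]
    refine hs.trans ?_
    have h2 : ((1 / (2 * ε) : ℝ) : ℝ*) ≤ b := by
      by_contra hlt
      exact hf (Hyperreal.finite_of_abs_le (r := 1 / (2 * ε))
        (by rw [abs_of_pos hb]; exact (not_le.1 hlt).le))
    have h3 := mul_le_mul_of_nonneg_left h2 (Hyperreal.coe_pos.2 hε).le
    refine le_trans (le_of_eq ?_) h3
    rw [← Hyperreal.coe_mul]
    congr 1
    field_simp

theorem dualityHom_surjective (ha : 0 < a) (hb : 0 < b) (hab : a * b = ω.toReal)
    (hb' : ¬ 0 < ArchimedeanClass.mk b) :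
    Function.Surjective (dualityHom ha.ne' hb.ne' hab) := by
  intro χ
  let f : AddChar (stdLattice a) Circle :=
    { toFun := fun r => χ (Multiplicative.ofAdd (stdClass (stdSection a ω r)))
      map_zero_eq_one' := by
        rw [stdClass_stdSection (n := 0) (by simp [HInt.toReal_zero]) 0
          (by simp [HInt.toReal_zero])]
        have h0 : finMk a ω 0 (by simp [HInt.toReal_zero]) = 0 := Subtype.ext (map_zero _)
        rw [h0]
        exact map_one χ
      map_add_eq_mul' := by
        rintro ⟨_, n, hn, rfl⟩ ⟨_, m, hm, rfl⟩
        rw [stdClass_stdSection hn ⟨_, n, hn, rfl⟩ rfl, stdClass_stdSection hm ⟨_, m, hm, rfl⟩ rfl,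
          stdClass_stdSection (finite_add_div hn hm) _ (stdPart_add_div hn hm), finMk_add hn hm,
          ← map_mul]
        rfl }
  have hf : Continuous f := (map_continuous χ).comp (continuous_ofAdd.comp
    (QuotientAddGroup.continuous_mk.comp lipschitzWith_stdSection.continuous))
  obtain ⟨θ, hθ⟩ := f.exists_eq_fourierChar (isClosed_stdLattice ha) hf
  have hχ : ∀ n (hn : 0 ≤ ArchimedeanClass.mk (n.toReal / a)),
      χ (Multiplicative.ofAdd (stdClass (finMk a ω n hn))) =
        Real.fourierChar (θ * stdPart (n.toReal / a)) := fun n hn => by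
    rw [← stdClass_stdSection hn ⟨_, n, hn, rfl⟩ rfl]
    exact hθ _
  -- The sign is that of the pairing. If `b` is finite, then `ω / a = b` represents zero in the time
  -- group, so `χ` is trivial there and `θ (st b)` is an integer.
  obtain ⟨s, hs, hsθ⟩ := exists_stdPart_div_eq hb hb' (-θ) fun hbf => by
    have hω : ω.toInt.toReal / a = b := by
      rw [HInt.toReal_toInt, ← hab, mul_div_cancel_left₀ _ ha.ne']
    have h1 := hχ ω.toInt (hω.symm ▸ hbf)
    have h0 : finMk a ω ω.toInt (hω.symm ▸ hbf) = 0 :=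
      Subtype.ext ((ScaledZMod.mk_eq_mk.2 ⟨1, by ring⟩).trans (map_zero (ScaledZMod.mk a ω)))
    rw [h0, hω] at h1
    obtain ⟨k, hk⟩ := Real.fourierChar_eq_one_iff.1 (h1.symm.trans (map_one χ))
    exact ⟨-k, by rw [neg_mul, hk, Int.cast_neg]⟩
  refine ⟨Multiplicative.ofAdd (stdClass (finMk b ω s hs)), PontryaginDual.ext fun t => ?_⟩
  obtain ⟨t', ht'⟩ := stdClass_surjective t.toAdd
  obtain rfl : t = Multiplicative.ofAdd (stdClass t') := by rw [ht']; rfl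
  obtain ⟨n, hn, rfl, -⟩ := exists_finMk_eq t'
  rw [dualityHom_stdClass, finPairing_finMk ha.ne' hb.ne' hab, hχ, hsθ]
  congr 1
  ring

/-- The standard parts of `(1/b) ℤ_ω` and `(1/a) ℤ_ω` are Pontryagin dual, for `ω = a b`. -/
theorem exists_duality (ha : 0 < a) (hb : 0 < b) (hab : a * b = ω.toReal)
    (hb' : ¬ 0 < ArchimedeanClass.mk b) :
    ∃ Φ : Multiplicative (StdGroup b ω) ≃ₜ* PontryaginDual (Multiplicative (StdGroup a ω)),
      ∀ (E : finElements b ω) (t : finElements a ω),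
        (Φ (Multiplicative.ofAdd (stdClass E)) (Multiplicative.ofAdd (stdClass t)) : ℂ) =
          complexStdPart (hyperPhase (-(E.1.val * t.1.val))) := by
  have := properSpace_finElements (ω := ω) ha
  have := properSpace_finElements (ω := ω) hb
  have : SigmaCompactSpace (StdGroup b ω) := by
    rw [← isSigmaCompact_univ_iff, ← stdClass_surjective.range_eq]
    exact isSigmaCompact_range QuotientAddGroup.continuous_mk
  have : SigmaCompactSpace (Multiplicative (StdGroup b ω)) := this
  have hbij : Function.Bijective (dualityHom ha.ne' hb.ne' hab) :=
    ⟨dualityHom_injective ha hb hab, dualityHom_surjective ha hb hab hb'⟩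
  -- Properness makes the source σ-compact and the time group, hence its dual, locally compact.
  have hopen := (dualityHom ha.ne' hb.ne' hab).isOpenMap_of_sigmaCompact hbij.2
    (continuous_dualityHom ha.ne' hb.ne' hab)
  let e := MulEquiv.ofBijective (dualityHom ha.ne' hb.ne' hab) hbij
  refine ⟨{ e with
    continuous_toFun := continuous_dualityHom ha.ne' hb.ne' hab
    continuous_invFun := e.toEquiv.continuous_symm_iff.2 hopen }, fun E t => ?_⟩
  exact coe_finPairing E t

end Duality

/-! ### Energies of a quantum clock -/

theorem mainTheorem7 (C : QuantumClock) :
    (∀ (G : Type v) [AddCommGroup G] [TopologicalSpace G] [IsTopologicalAddGroup G],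
      Set.BijOn
        (fun (χ : PontryaginDual (Multiplicative G)) (t : G) => (χ (Multiplicative.ofAdd t) : ℂ))
        Set.univ (energyPhases.{u} G)) ∧
    (∀ (E : ScaledZMod C.ωir C.ω) (t : ScaledZMod C.ωuv C.ω),
      StarHilb.braket (C.planeWave E) (C.timeState t) = hyperPhase (-(E.val * t.val))) ∧
    IsStateGroupIso C.pair.Z C.pair.X.classicalStates C.planeWave ∧
    (∃ Φ : Multiplicative C.StdEnergy ≃ₜ* PontryaginDual (Multiplicative C.StdTime),
      ∀ (E : finElements C.ωir C.ω) (t : finElements C.ωuv C.ω),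
        (Φ (Multiplicative.ofAdd (stdClass E)) (Multiplicative.ofAdd (stdClass t)) : ℂ) =
          complexStdPart (hyperPhase (-(E.1.val * t.1.val)))) ∧
    (∀ c : C.StdTime → ℂ, c ∈ energyPhases.{u} C.StdTime ↔
      ∃! e : C.StdEnergy, ∀ E : finElements C.ωir C.ω, stdClass E = e →
        ∀ t : finElements C.ωuv C.ω,
          c (stdClass t) = complexStdPart (StarHilb.braket (C.planeWave E) (C.timeState t))) := by
  have duality := exists_duality C.ωuv_pos C.ωir_pos C.ω_eq
    C.ωir_not_infinitesimal
  refine ⟨fun G _ _ _ => bijOn_energyPhases, C.braket_planeWave_timeState, C.planeWave_iso,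
    duality, fun c => ?_⟩
  obtain ⟨Φ, hΦ⟩ := duality
  -- The condition on `e` says that `c` is the character `Φ e`: every class has a representative
  -- `E`, and the phase does not depend on it.
  have key : ∀ e : C.StdEnergy, (∀ E : finElements C.ωir C.ω, stdClass E = e →
      ∀ t : finElements C.ωuv C.ω,
        c (stdClass t) = complexStdPart (StarHilb.braket (C.planeWave E) (C.timeState t))) ↔
      (fun t : C.StdTime => (Φ (Multiplicative.ofAdd e) (Multiplicative.ofAdd t) : ℂ)) = c := by
    intro e
    simp only [C.braket_planeWave_timeState, ← hΦ]
    constructor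
    · intro h
      funext t
      obtain ⟨E, rfl⟩ := stdClass_surjective e
      obtain ⟨t, rfl⟩ := stdClass_surjective t
      exact (h E rfl t).symm
    · rintro rfl E rfl t
      rfl
  simp only [key]
  have hbij := bijOn_energyPhases.{u} (G := C.StdTime)
  constructor
  · intro hc
    obtain ⟨χ, -, hχ⟩ := hbij.surjOn hc
    obtain ⟨e, rfl⟩ := Φ.surjective χ
    exact ⟨e.toAdd, hχ, fun e' he' => Multiplicative.ofAdd.injective (Φ.injective
      (hbij.injOn (Set.mem_univ _) (Set.mem_univ _) (he'.trans hχ.symm)))⟩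
  · rintro ⟨e, rfl, -⟩
    exact hbij.mapsTo (Set.mem_univ _)
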